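/- Formulas of $\mathrm{BAPA}$ (Boolean algebra with Presburger arithmetic) have two sorts of variables, set variables $x$ and integer variables $k$, and are given by the grammar $$F ::= A \mid F_1\land F_2\mid F_1\lor F_2\mid \lnot F\mid \exists x.F\mid\forall x.F\mid\exists k.F\mid\forall k.F,$$ $$A ::= B_1=B_2\mid B_1\subseteq B_2\mid T_1=T_2\mid T_1<T_2\mid c\,|\,T,$$ $$B ::= x\mid \emptyset\mid \mathcal U\mid B_1\cup B_2\mid B_1\cap B_2\mid B^{c},$$ $$T ::= k\mid c\mid \mathrm{MAXC}\mid T_1+T_2\mid T_1-T_2\mid c\cdot T\mid |B|,$$ where $c$ ranges over integer constants. A model with finite universe is given by a finite (possibly empty) set $U$: set variables and set quantifiers range over all subsets of $U$, integer variables and integer quantifiers range over $\mathbb Z$, $\mathcal U$ denotes $U$, $B^c$ is the complement in $U$, $|B|$ is the cardinality of $B$, $\mathrm{MAXC}=|U|$, $c\,|\,T$ means that $c$ divides $T$ in $\mathbb Z$ (for $c=0$: that $T=0$), and all other symbols have their standard meaning. A sentence is a formula without free variables of either sort; it is valid if it is true in every model with finite universe. Theorem. The validity of $\mathrm{BAPA}$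 sentences over the family of all models with finite universe of uninterpreted elements is decidable. That is, under a standard injective Gödel numbering of formulas (each syntax tree is coded by pairing a tag for its root with the codes of its arguments), the set of Gödel numbers of valid $\mathrm{BAPA}$ sentences is a decidable (recursive) set of natural numbers. -/

import Mathlib

universe u

namespace BAPA

/-- Set terms: set variables `x₀, x₁, …`, the empty set, the universal set, union, intersection
and complement. -/
inductive SetTerm : Type where
  | var (x : ℕ)
  | empty
  | univ
  | union (b₁ b₂ : SetTerm)
  | inter (b₁ b₂ : SetTerm)
  | compl (b : SetTerm)

/-- Integer terms: integer variables `k₀, k₁, …`, integer constants, the size `MAXC` of the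
universe, sums, differences, multiples by a constant, and cardinalities of set terms. -/
inductive IntTerm : Type where
  | var (k : ℕ)
  | const (c : ℤ)
  | maxCard
  | add (t₁ t₂ : IntTerm)
  | sub (t₁ t₂ : IntTerm)
  | smul (c : ℤ) (t : IntTerm)
  | card (b : SetTerm)

/-- Formulas of Boolean algebra with Presburger arithmetic. There are two sorts of variables,
each named by natural numbers, and quantifiers over both sorts. -/
inductive Formula : Type where
  | setEq (b₁ b₂ : SetTerm)
  | subset (b₁ b₂ : SetTerm)
  | intEq (t₁ t₂ : IntTerm)
  | lt (t₁ t₂ : IntTerm)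
  | dvd (c : ℤ) (t : IntTerm)
  | and (F₁ F₂ : Formula)
  | or (F₁ F₂ : Formula)
  | neg (F : Formula)
  | exSet (x : ℕ) (F : Formula)
  | allSet (x : ℕ) (F : Formula)
  | exInt (k : ℕ) (F : Formula)
  | allInt (k : ℕ) (F : Formula)

/-! ### Semantics over a universe `U` of uninterpreted elements -/

/-- The value of a set term under an assignment `ρ` of subsets of `U` to the set variables. -/
def SetTerm.eval {U : Type u} (ρ : ℕ → Set U) : SetTerm → Set U
  | .var x => ρ x
  | .empty => ∅
  | .univ => Set.univ
  | .union b₁ b₂ => b₁.eval ρ ∪ b₂.eval ρ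
  | .inter b₁ b₂ => b₁.eval ρ ∩ b₂.eval ρ
  | .compl b => (b.eval ρ)ᶜ

/-- The value of an integer term; used for finite `U` only, where `Nat.card` and `Set.ncard` are
the true cardinalities. -/
noncomputable def IntTerm.eval {U : Type u} (ρ : ℕ → Set U) (σ : ℕ → ℤ) : IntTerm → ℤ
  | .var k => σ k
  | .const c => c
  | .maxCard => (Nat.card U : ℤ)
  | .add t₁ t₂ => t₁.eval ρ σ + t₂.eval ρ σ
  | .sub t₁ t₂ => t₁.eval ρ σ - t₂.eval ρ σ
  | .smul c t => c * t.eval ρ σ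
  | .card b => ((b.eval ρ).ncard : ℤ)

/-- Truth of a formula in the model with universe `U`, under assignments to the set variables
(subsets of `U`) and to the integer variables. -/
def Formula.Sat {U : Type u} : Formula → (ℕ → Set U) → (ℕ → ℤ) → Prop
  | .setEq b₁ b₂, ρ, _ => b₁.eval ρ = b₂.eval ρ
  | .subset b₁ b₂, ρ, _ => b₁.eval ρ ⊆ b₂.eval ρ
  | .intEq t₁ t₂, ρ, σ => t₁.eval ρ σ = t₂.eval ρ σ
  | .lt t₁ t₂, ρ, σ => t₁.eval ρ σ < t₂.eval ρ σ
  | .dvd c t, ρ, σ => c ∣ t.eval ρ σ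
  | .and F₁ F₂, ρ, σ => F₁.Sat ρ σ ∧ F₂.Sat ρ σ
  | .or F₁ F₂, ρ, σ => F₁.Sat ρ σ ∨ F₂.Sat ρ σ
  | .neg F, ρ, σ => ¬ F.Sat ρ σ
  | .exSet x F, ρ, σ => ∃ s : Set U, F.Sat (Function.update ρ x s) σ
  | .allSet x F, ρ, σ => ∀ s : Set U, F.Sat (Function.update ρ x s) σ
  | .exInt k F, ρ, σ => ∃ n : ℤ, F.Sat ρ (Function.update σ k n)
  | .allInt k F, ρ, σ => ∀ n : ℤ, F.Sat ρ (Function.update σ k n)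

/-- Validity over the family of all models with a finite universe (possibly empty). -/
def Formula.Valid (F : Formula) : Prop :=
  ∀ (U : Type u) [Finite U] (ρ : ℕ → Set U) (σ : ℕ → ℤ), F.Sat ρ σ

/-! ### Free variables and sentences -/

/-- The set variables of a set term. -/
def SetTerm.setVars : SetTerm → Finset ℕ
  | .var x => {x}
  | .empty => ∅
  | .univ => ∅
  | .union b₁ b₂ => b₁.setVars ∪ b₂.setVars
  | .inter b₁ b₂ => b₁.setVars ∪ b₂.setVars
  | .compl b => b.setVars

/-- The set variables of an integer term. -/
def IntTerm.setVars : IntTerm → Finset ℕ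
  | .var _ => ∅
  | .const _ => ∅
  | .maxCard => ∅
  | .add t₁ t₂ => t₁.setVars ∪ t₂.setVars
  | .sub t₁ t₂ => t₁.setVars ∪ t₂.setVars
  | .smul _ t => t.setVars
  | .card b => b.setVars

/-- The integer variables of an integer term. -/
def IntTerm.intVars : IntTerm → Finset ℕ
  | .var k => {k}
  | .const _ => ∅
  | .maxCard => ∅
  | .add t₁ t₂ => t₁.intVars ∪ t₂.intVars
  | .sub t₁ t₂ => t₁.intVars ∪ t₂.intVars
  | .smul _ t => t.intVars
  | .card _ => ∅

/-- The free set variables of a formula. -/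
def Formula.freeSetVars : Formula → Finset ℕ
  | .setEq b₁ b₂ => b₁.setVars ∪ b₂.setVars
  | .subset b₁ b₂ => b₁.setVars ∪ b₂.setVars
  | .intEq t₁ t₂ => t₁.setVars ∪ t₂.setVars
  | .lt t₁ t₂ => t₁.setVars ∪ t₂.setVars
  | .dvd _ t => t.setVars
  | .and F₁ F₂ => F₁.freeSetVars ∪ F₂.freeSetVars
  | .or F₁ F₂ => F₁.freeSetVars ∪ F₂.freeSetVars
  | .neg F => F.freeSetVars
  | .exSet x F => F.freeSetVars.erase x
  | .allSet x F => F.freeSetVars.erase x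
  | .exInt _ F => F.freeSetVars
  | .allInt _ F => F.freeSetVars

/-- The free integer variables of a formula. -/
def Formula.freeIntVars : Formula → Finset ℕ
  | .setEq _ _ => ∅
  | .subset _ _ => ∅
  | .intEq t₁ t₂ => t₁.intVars ∪ t₂.intVars
  | .lt t₁ t₂ => t₁.intVars ∪ t₂.intVars
  | .dvd _ t => t.intVars
  | .and F₁ F₂ => F₁.freeIntVars ∪ F₂.freeIntVars
  | .or F₁ F₂ => F₁.freeIntVars ∪ F₂.freeIntVars
  | .neg F => F.freeIntVars
  | .exSet _ F => F.freeIntVars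
  | .allSet _ F => F.freeIntVars
  | .exInt k F => F.freeIntVars.erase k
  | .allInt k F => F.freeIntVars.erase k

/-- A sentence is a formula without free variables of either sort. -/
def Formula.IsSentence (F : Formula) : Prop :=
  F.freeSetVars = ∅ ∧ F.freeIntVars = ∅

/-! ### Gödel numbering

A syntax tree is numbered by the pair of a tag for its root and the numbers of its arguments
(integers being numbered by the standard bijection of `ℤ` with `ℕ`). The successor makes the
number of each proper subtree strictly smaller than that of the tree. -/

/-- The number of a node with the given tag and (paired) arguments. -/
def node (tag args : ℕ) : ℕ := Nat.pair tag args + 1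

/-- The Gödel number of a set term. -/
def SetTerm.code : SetTerm → ℕ
  | .var x => node 0 x
  | .empty => node 1 0
  | .univ => node 2 0
  | .union b₁ b₂ => node 3 (Nat.pair b₁.code b₂.code)
  | .inter b₁ b₂ => node 4 (Nat.pair b₁.code b₂.code)
  | .compl b => node 5 b.code

/-- The Gödel number of an integer term. -/
def IntTerm.code : IntTerm → ℕ
  | .var k => node 0 k
  | .const c => node 1 (Encodable.encode c)
  | .maxCard => node 2 0
  | .add t₁ t₂ => node 3 (Nat.pair t₁.code t₂.code)
  | .sub t₁ t₂ => node 4 (Nat.pair t₁.code t₂.code)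
  | .smul c t => node 5 (Nat.pair (Encodable.encode c) t.code)
  | .card b => node 6 b.code

/-- The Gödel number of a formula. -/
def Formula.code : Formula → ℕ
  | .setEq b₁ b₂ => node 0 (Nat.pair b₁.code b₂.code)
  | .subset b₁ b₂ => node 1 (Nat.pair b₁.code b₂.code)
  | .intEq t₁ t₂ => node 2 (Nat.pair t₁.code t₂.code)
  | .lt t₁ t₂ => node 3 (Nat.pair t₁.code t₂.code)
  | .dvd c t => node 4 (Nat.pair (Encodable.encode c) t.code)
  | .and F₁ F₂ => node 5 (Nat.pair F₁.code F₂.code)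
  | .or F₁ F₂ => node 6 (Nat.pair F₁.code F₂.code)
  | .neg F => node 7 F.code
  | .exSet x F => node 8 (Nat.pair x F.code)
  | .allSet x F => node 9 (Nat.pair x F.code)
  | .exInt k F => node 10 (Nat.pair k F.code)
  | .allInt k F => node 11 (Nat.pair k F.code)

theorem node_inj {a b c d : ℕ} : node a b = node c d ↔ a = c ∧ b = d := by
  simp [node, Nat.pair_eq_pair]

theorem SetTerm.code_injective : Function.Injective SetTerm.code := by
  intro s
  induction s <;> intro t h <;> cases t <;>
    simp_all [SetTerm.code, node_inj, Nat.pair_eq_pair]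
  all_goals grind

theorem IntTerm.code_injective : Function.Injective IntTerm.code := by
  intro s
  induction s <;> intro t h <;> cases t <;>
    simp_all [IntTerm.code, node_inj, Nat.pair_eq_pair, SetTerm.code_injective.eq_iff]
  all_goals grind

/-- Distinct formulas have distinct Gödel numbers. -/
theorem Formula.code_injective : Function.Injective Formula.code := by
  intro s
  induction s <;> intro t h <;> cases t <;>
    simp_all [Formula.code, node_inj, Nat.pair_eq_pair, SetTerm.code_injective.eq_iff,
      IntTerm.code_injective.eq_iff]
  all_goals grind

end BAPA

universe v

namespace BAPA

open Finset
open scoped Nat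

/-! ### Indistinguishability of integer vectors by small linear forms -/

/-! The argument is an Ehrenfeucht–Fraïssé game in which the positions are integer vectors. A finite
model with values for the variables below `n` is summarized by `vec`: the integer values, and for
each set `A` of variables the number of elements lying in exactly the sets named by `A` (a Venn
region). Set relations depend only on which regions are inhabited, and integer terms are linear
forms in this vector (`IntTerm.eval_eq`). So atoms are decided by signs of small linear forms and by
congruences, and `Indist N` says that two vectors agree on these up to size `N` and modulo `N!`.

The core is `Indist.exists_update`: if two vectors agree to precision `refine N`, any new coordinate
on the left has an answer on the right that preserves precision `N`, and the answer is bounded in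
terms of the right vector. An integer quantifier is one such move. A set quantifier asks how many
elements of each region go into the new set, which is at most `2 ^ n` moves (`Indist.exists_set`).
By induction, `Formula.sat_iff_of_indist` shows that agreement to precision `prec n F.code` forces
agreement on `F`.

The bound on answers makes everything finite. Playing a model against itself bounds the witnesses of
integer quantifiers (`Formula.exists_int_iff_bounded`), and playing for the size of the universe
shows that a sentence is valid as soon as it holds in all models of explicitly bounded size
(`Formula.valid_iff`). What remains is brute force: a primitive recursive evaluator on codes
(`exists_primrec_sat`) and a primitive recursive test for being the code of a sentence
(`exists_primrec_formula`). -/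

/-- The vectors `a` and `b` (restricted to `D`) cannot be told apart by the signs of linear forms
with coefficients at most `N`, nor by congruences modulo `N!`. -/
structure Indist {ι : Type*} (N : ℕ) (D : Finset ι) (a b : ι → ℤ) : Prop where
  pos : ∀ (c : ι → ℤ) (d : ℤ), (∀ i ∈ D, |c i| ≤ N) → |d| ≤ N →
    (0 < ∑ i ∈ D, c i * a i + d ↔ 0 < ∑ i ∈ D, c i * b i + d)
  modEq : ∀ i ∈ D, a i ≡ b i [ZMOD (N ! : ℕ)]

/-- The precision that allows one more coordinate to be matched with precision `N`. -/
def refine (N : ℕ) : ℕ := 3 * (N ! * N !)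

theorem le_refine (N : ℕ) : N ≤ refine N := by
  have := Nat.self_le_factorial N
  have := Nat.factorial_pos N
  unfold refine
  nlinarith

theorem two_mul_le_refine (N : ℕ) : 2 * N ≤ refine N := by
  have := Nat.self_le_factorial N
  have := Nat.factorial_pos N
  unfold refine
  nlinarith

namespace Indist

variable {ι : Type*} {N N' : ℕ} {D D' : Finset ι} {a b : ι → ℤ}

theorem refl (N : ℕ) (D : Finset ι) (a : ι → ℤ) : Indist N D a a :=
  ⟨fun _ _ _ _ => Iff.rfl, fun _ _ => Int.ModEq.refl _⟩

theorem symm (h : Indist N D a b) : Indist N D b a :=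
  ⟨fun c d hc hd => (h.pos c d hc hd).symm, fun i hi => (h.modEq i hi).symm⟩

theorem congr {a' b' : ι → ℤ} (h : Indist N D a b) (ha : ∀ i ∈ D, a' i = a i)
    (hb : ∀ i ∈ D, b' i = b i) : Indist N D a' b' := by
  refine ⟨fun c d hc hd => ?_, fun i hi => ?_⟩
  · have ea : ∑ i ∈ D, c i * a' i = ∑ i ∈ D, c i * a i :=
      sum_congr rfl fun i hi => by rw [ha i hi]
    have eb : ∑ i ∈ D, c i * b' i = ∑ i ∈ D, c i * b i :=
      sum_congr rfl fun i hi => by rw [hb i hi]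
    rw [ea, eb]
    exact h.pos c d hc hd
  · rw [ha i hi, hb i hi]
    exact h.modEq i hi

theorem anti (h : Indist N' D a b) (hN : N ≤ N') : Indist N D a b := by
  have hN' : (N : ℤ) ≤ N' := by exact_mod_cast hN
  exact ⟨fun c d hc hd => h.pos c d (fun i hi => (hc i hi).trans hN') (hd.trans hN'),
    fun i hi => (h.modEq i hi).of_dvd (by exact_mod_cast Nat.factorial_dvd_factorial hN)⟩

theorem subset (h : Indist N D' a b) (hD : D ⊆ D') : Indist N D a b := by
  classical
  refine ⟨fun c d hc hd => ?_, fun i hi => h.modEq i (hD hi)⟩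
  -- A form on `D` is a form on `D'` with zero coefficients outside `D`.
  have key : ∀ v : ι → ℤ,
      ∑ i ∈ D', (if i ∈ D then c i else 0) * v i = ∑ i ∈ D, c i * v i := by
    intro v
    rw [← sum_subset hD fun i _ hi => by simp [hi]]
    exact sum_congr rfl fun i hi => by simp [hi]
  rw [← key a, ← key b]
  refine h.pos _ d (fun i _ => ?_) hd
  by_cases hi : i ∈ D
  · simpa [hi] using hc i hi
  · simp [hi]

theorem neg_iff (h : Indist N D a b) {c : ι → ℤ} {d : ℤ} (hc : ∀ i ∈ D, |c i| ≤ N)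
    (hd : |d| ≤ N) : ∑ i ∈ D, c i * a i + d < 0 ↔ ∑ i ∈ D, c i * b i + d < 0 := by
  have := h.pos (fun i => -c i) (-d) (by simpa using hc) (by simpa using hd)
  simp only [neg_mul, sum_neg_distrib] at this
  exact ⟨fun _ => by linarith [this.1 (by linarith)], fun _ => by linarith [this.2 (by linarith)]⟩

theorem eq_iff (h : Indist N D a b) {c : ι → ℤ} {d : ℤ} (hc : ∀ i ∈ D, |c i| ≤ N)
    (hd : |d| ≤ N) : ∑ i ∈ D, c i * a i + d = 0 ↔ ∑ i ∈ D, c i * b i + d = 0 := by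
  have h₁ := h.pos c d hc hd
  have h₂ := h.neg_iff hc hd
  omega

theorem sum_modEq (h : Indist N D a b) (c : ι → ℤ) (d : ℤ) :
    ∑ i ∈ D, c i * a i + d ≡ ∑ i ∈ D, c i * b i + d [ZMOD (N ! : ℕ)] := by
  refine Int.ModEq.add ?_ rfl
  refine (Int.modEq_iff_dvd.2 ?_)
  rw [← sum_sub_distrib]
  refine dvd_sum fun i hi => ?_
  rw [← mul_sub]
  exact Dvd.dvd.mul_left (Int.modEq_iff_dvd.1 (h.modEq i hi)) _

theorem neg (h : Indist N D a b) : Indist N D (-a) (-b) := by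
  refine ⟨fun c d hc hd => ?_, fun i hi => (h.modEq i hi).neg⟩
  have := h.pos (fun i => -c i) d (by simpa using hc) hd
  simpa using this

/-- Let `z` be the largest value at `a`, not above `N! * x`, of a form with coefficients at most `N!
* N`. The answer `y` is placed so that `N! * y` lies above the value `z'` of the same form at `b` by
a short distance `r`, congruent to the original gap modulo `(N!)²`. No form of this size has a value
strictly between `z` and `N! * x`, so a gap that is too long may be shortened without changing any
comparison. -/
theorem exists_extend_of_nonneg (h : Indist (BAPA.refine N) D a b) {x : ℤ} (hx : 0 ≤ x) :
    ∃ y : ℤ, x ≡ y [ZMOD (N ! : ℕ)] ∧ |y| ≤ N ! * (∑ i ∈ D, |b i| + 2) ∧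
      ∀ (c : ι → ℤ) (d : ℤ), (∀ i ∈ D, |c i| ≤ N ! * N) → |d| ≤ N ! * N →
        (∑ i ∈ D, c i * a i + d < N ! * x ↔ ∑ i ∈ D, c i * b i + d < N ! * y) ∧
        (N ! * x < ∑ i ∈ D, c i * a i + d ↔ N ! * y < ∑ i ∈ D, c i * b i + d) := by
  set E : ℤ := ((N ! : ℕ) : ℤ) with hE
  have hE1 : 1 ≤ E := by rw [hE]; exact_mod_cast Nat.factorial_pos N
  have hNE : (N : ℤ) ≤ E := by rw [hE]; exact_mod_cast Nat.self_le_factorial N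
  have hN0 : (0 : ℤ) ≤ N := by positivity
  have hR : ((BAPA.refine N : ℕ) : ℤ) = 3 * (E * E) := by simp [BAPA.refine, hE]
  have hEN0 : 0 ≤ E * N := by positivity
  have hEN : E * N ≤ E * E := by nlinarith
  have hdvd : E * E ∣ ((BAPA.refine N)! : ℕ) := by
    have : N ! * N ! ∣ (BAPA.refine N)! :=
      Nat.dvd_factorial (by positivity) (by unfold BAPA.refine; omega)
    rw [hE]; exact_mod_cast this
  let S : ℤ → Prop := fun z => z ≤ E * x ∧ ∃ (c : ι → ℤ) (d : ℤ),
    (∀ i ∈ D, |c i| ≤ E * N) ∧ |d| ≤ E * N ∧ ∑ i ∈ D, c i * a i + d = z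
  -- The zero form has a value below `N! * x` because `0 ≤ x`, so there is something to maximize
  -- over.
  obtain ⟨z, ⟨hzx, c₀, d₀, hc₀, hd₀, hz⟩, hmax⟩ := Int.exists_greatest_of_bdd (P := S)
    ⟨E * x, fun z hz => hz.1⟩ ⟨0, by positivity, 0, 0, fun i _ => by simpa using hEN0, by simpa using hEN0, by simp⟩
  set δ := E * x - z with hδ
  have hδ0 : 0 ≤ δ := by omega
  -- The residue of the gap is taken in `1, …, E * E` rather than from `0`, so that a positive gap
  -- stays positive; only a zero gap gives `r = 0`.
  obtain ⟨r, hr0, hrδ, hrE, hrz, hrm⟩ : ∃ r : ℤ, 0 ≤ r ∧ r ≤ δ ∧ r ≤ E * E ∧ (r = 0 → δ = 0) ∧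
      E * E ∣ δ - r := by
    have hEE : 0 < E * E := by positivity
    rcases hδ0.eq_or_lt with h0 | h0
    · exact ⟨0, le_rfl, hδ0, hEE.le, fun _ => h0.symm, by simp [← h0]⟩
    · have h1 := Int.emod_nonneg (δ - 1) hEE.ne'
      have h2 := Int.emod_lt_of_pos (δ - 1) hEE
      have h3 : (δ - 1) % (E * E) ≤ δ - 1 := by
        have := Int.mul_ediv_add_emod (δ - 1) (E * E)
        have := mul_nonneg hEE.le (Int.ediv_nonneg (a := δ - 1) (by omega) hEE.le)
        omega
      refine ⟨(δ - 1) % (E * E) + 1, by omega, by omega, by omega, by omega, ?_⟩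
      have := Int.dvd_self_sub_emod (x := δ - 1) (m := E * E)
      have e : δ - ((δ - 1) % (E * E) + 1) = δ - 1 - (δ - 1) % (E * E) := by ring
      rwa [e]
  set z' := ∑ i ∈ D, c₀ i * b i + d₀ with hz'
  have hzz' : E * E ∣ z' - z := by
    have := Int.modEq_iff_dvd.1 (h.sum_modEq c₀ d₀)
    rw [hz] at this
    exact hdvd.trans this
  have hy : E * E ∣ z' + r - E * x := by
    have : z' + r - E * x = (z' - z) - (δ - r) := by rw [hδ]; ring
    rw [this]
    exact dvd_sub hzz' hrm
  -- Working modulo `E * E` serves two ends: `z' + r` is divisible by `E`, and the quotient is still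
  -- congruent to `x` modulo `E`.
  obtain ⟨q, hq⟩ := hy
  have hy : z' + r = E * (x + E * q) := by linarith [mul_assoc E E q]
  -- The difference of two forms contributes at most `2 * (E * N)` and the shift `e` at most `E *
  -- E`; this is the factor 3 in `refine`.
  have cmp : ∀ (c : ι → ℤ) (d e : ℤ), (∀ i ∈ D, |c i| ≤ E * N) → |d| ≤ E * N → |e| ≤ E * E →
      (0 < (∑ i ∈ D, c i * a i + d) - z + e ↔ 0 < (∑ i ∈ D, c i * b i + d) - z' + e) := by
    intro c d e hc hd he
    have := h.pos (fun i => c i - c₀ i) (d - d₀ + e)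
      (fun i hi => by
        have h1 := abs_sub (c i) (c₀ i)
        have h2 := hc i hi
        have h3 := hc₀ i hi
        rw [hR]; linarith)
      (by
        have h1 := abs_sub d d₀
        have h2 := abs_add_le (d - d₀) e
        rw [hR]; linarith)
    simp only [sub_mul, sum_sub_distrib] at this
    rw [← hz, hz']
    convert this using 2 <;> ring
  refine ⟨x + E * q, ?_, ?_, fun c d hc hd => ?_⟩
  · exact Int.modEq_iff_dvd.2 ⟨q, by ring⟩
  · have h1 : |z'| ≤ E * N * ∑ i ∈ D, |b i| + E * N := by
      rw [hz', mul_sum]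
      refine (abs_add_le _ _).trans (add_le_add ?_ hd₀)
      refine (abs_sum_le_sum_abs _ _).trans (sum_le_sum fun i hi => ?_)
      rw [abs_mul]
      exact mul_le_mul_of_nonneg_right (hc₀ i hi) (abs_nonneg _)
    have hs : 0 ≤ ∑ i ∈ D, |b i| := sum_nonneg fun i _ => abs_nonneg _
    have h2 : E * |x + E * q| ≤ E * (E * (∑ i ∈ D, |b i| + 2)) := by
      rw [← abs_of_pos (show 0 < E by omega), ← abs_mul, abs_of_pos (show 0 < E by omega), ← hy]
      have := abs_add_le z' r
      rw [abs_of_nonneg hr0] at this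
      have h3 := mul_le_mul_of_nonneg_right hEN hs
      nlinarith
    exact le_of_mul_le_mul_left h2 (by omega)
  · rw [← hy]
    set t := ∑ i ∈ D, c i * a i + d with ht
    set t' := ∑ i ∈ D, c i * b i + d with ht'
    have hr' : |-r| ≤ E * E := by rw [abs_neg, abs_of_nonneg hr0]; exact hrE
    have c0 := cmp c d 0 hc hd (by simp; positivity)
    have c1 := cmp c d (-r) hc hd hr'
    have c2 := h.neg_iff (c := fun i => c i - c₀ i) (d := d - d₀)
      (fun i hi => by
        have h1 := abs_sub (c i) (c₀ i)
        have h2 := hc i hi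
        have h3 := hc₀ i hi
        rw [hR]; linarith)
      (by
        have h1 := abs_sub d d₀
        rw [hR]; linarith)
    simp only [sub_mul, sum_sub_distrib] at c2
    have c2 : t < z ↔ t' < z' := by
      rw [← hz, hz', ht, ht']
      exact ⟨fun _ => by linarith [c2.1 (by linarith)], fun _ => by linarith [c2.2 (by linarith)]⟩
    rw [← ht, ← ht'] at c0 c1
    -- Below `E * x`, maximality gives `t ≤ z`, and the comparison with `z` transfers. Above it, `t
    -- - z` exceeds the gap and hence `r`, and the comparison with `z + r` transfers.
    by_cases htx : t ≤ E * x
    · have := hmax t ⟨htx, c, d, hc, hd, rfl⟩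
      by_cases hr : r = 0
      · have := hrz hr
        omega
      · omega
    · omega

theorem exists_extend (h : Indist (BAPA.refine N) D a b) (x : ℤ) :
    ∃ y : ℤ, x ≡ y [ZMOD (N ! : ℕ)] ∧ |y| ≤ N ! * (∑ i ∈ D, |b i| + 2) ∧
      ∀ (c : ι → ℤ) (d : ℤ), (∀ i ∈ D, |c i| ≤ N ! * N) → |d| ≤ N ! * N →
        (∑ i ∈ D, c i * a i + d < N ! * x ↔ ∑ i ∈ D, c i * b i + d < N ! * y) ∧
        (N ! * x < ∑ i ∈ D, c i * a i + d ↔ N ! * y < ∑ i ∈ D, c i * b i + d) := by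
  rcases le_total 0 x with hx | hx
  · exact h.exists_extend_of_nonneg hx
  · obtain ⟨y, h1, h2, h3⟩ := h.neg.exists_extend_of_nonneg (neg_nonneg.2 hx)
    refine ⟨-y, by simpa using h1.neg, by simpa using h2, fun c d hc hd => ?_⟩
    have := h3 c (-d) hc (by simpa using hd)
    simp only [Pi.neg_apply, mul_neg, sum_neg_distrib] at this ⊢
    constructor
    · exact ⟨fun _ => by linarith [this.2.1 (by linarith)],
        fun _ => by linarith [this.2.2 (by linarith)]⟩
    · exact ⟨fun _ => by linarith [this.1.1 (by linarith)],
        fun _ => by linarith [this.1.2 (by linarith)]⟩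

/-- A form containing the new coordinate with coefficient `c j ≠ 0` is multiplied by `N! / |c j|`.
Its sign then compares `N!` times the new coordinate with a form whose coefficients are at most `N!
* N`, which is exactly what `exists_extend` controls. -/
theorem exists_update [DecidableEq ι] (h : Indist (BAPA.refine N) D a b) {j : ι} (hj : j ∉ D) :
    ∃ y : ℤ, |y| ≤ N ! * (∑ i ∈ D, |b i| + 2) ∧
      Indist N (insert j D) a (Function.update b j y) := by
  obtain ⟨y, hmod, hle, hy⟩ := h.exists_extend (a j)
  have hb : ∀ i ∈ D, Function.update b j y i = b i := fun i hi =>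
    Function.update_of_ne (by rintro rfl; exact hj hi) _ _
  refine ⟨y, hle, fun c d hc hd => ?_, fun i hi => ?_⟩
  · have eb : ∑ i ∈ D, c i * Function.update b j y i = ∑ i ∈ D, c i * b i :=
      sum_congr rfl fun i hi => by rw [hb i hi]
    rw [sum_insert hj, sum_insert hj, Function.update_self, eb]
    have hc' : ∀ i ∈ D, |c i| ≤ N := fun i hi => hc i (mem_insert_of_mem hi)
    have hej := hc j (mem_insert_self j D)
    rcases eq_or_ne (c j) 0 with he | he
    · simpa [he] using (h.anti (le_refine N)).pos c d hc' hd
    have hq : |c j| ∣ (N ! : ℕ) := by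
      rw [Int.abs_eq_natAbs]
      exact_mod_cast Nat.dvd_factorial (Int.natAbs_pos.2 he) (by zify; exact hej)
    obtain ⟨q, hq⟩ := hq
    have hE : (0 : ℤ) < (N ! : ℕ) := by exact_mod_cast Nat.factorial_pos N
    have hcj : 0 < |c j| := abs_pos.2 he
    have hq0 : 0 < q := by
      rw [hq] at hE
      exact pos_of_mul_pos_right hE hcj.le
    have hqE : q ≤ (N ! : ℕ) := by rw [hq]; nlinarith
    have bound : ∀ z : ℤ, |z| ≤ N → |q * z| ≤ (N ! : ℕ) * N := fun z hz => by
      rw [abs_mul, abs_of_pos hq0]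
      exact mul_le_mul hqE hz (abs_nonneg _) hE.le
    have hscale : ∀ v : ℤ, 0 < v ↔ 0 < q * v := fun v => (mul_pos_iff_of_pos_left hq0).symm
    rw [hscale, hscale (_ + _)]
    rcases lt_or_gt_of_ne he with he | he
    · rw [abs_of_neg he] at hq
      have := (hy (fun i => q * c i) (q * d) (fun i hi => bound _ (hc' i hi)) (bound _ hd)).2
      rw [hq] at this
      simp only [mul_assoc, ← mul_sum] at this
      exact ⟨fun _ => by linarith [this.1 (by linarith)],
        fun _ => by linarith [this.2 (by linarith)]⟩
    · rw [abs_of_pos he] at hq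
      have := (hy (fun i => -(q * c i)) (-(q * d)) (fun i hi => by
        rw [abs_neg]; exact bound _ (hc' i hi)) (by rw [abs_neg]; exact bound _ hd)).1
      rw [hq] at this
      simp only [neg_mul, mul_assoc, sum_neg_distrib, ← mul_sum] at this
      exact ⟨fun _ => by linarith [this.1 (by linarith)],
        fun _ => by linarith [this.2 (by linarith)]⟩
  · rcases mem_insert.1 hi with rfl | hi
    · simpa using hmod
    · rw [hb i hi]
      exact (h.anti (le_refine N)).modEq i hi

theorem exists_extend_finset [DecidableEq ι] (J : Finset ι) (hJ : Disjoint D J)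
    (h : Indist (BAPA.refine^[#J] N) D a b) :
    ∃ b' : ι → ℤ, (∀ i ∈ D, b' i = b i) ∧ Indist N (D ∪ J) a b' := by
  induction J using Finset.induction_on generalizing N with
  | empty => exact ⟨b, fun _ _ => rfl, by simpa using h⟩
  | insert j J hj ih =>
    rw [card_insert_of_notMem hj, Function.iterate_succ_apply] at h
    rw [disjoint_insert_right] at hJ
    obtain ⟨b', hb', h'⟩ := ih hJ.2 h
    have hjD : j ∉ D ∪ J := by simp [hJ.1, hj]
    obtain ⟨y, -, hy⟩ := h'.exists_update hjD
    refine ⟨Function.update b' j y, fun i hi => ?_, by rwa [union_insert]⟩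
    rw [Function.update_of_ne (by rintro rfl; exact hJ.1 hi), hb' i hi]

end Indist

end BAPA

namespace BAPA

open Finset
open scoped Nat

/-! ### Types of elements and the vector of a model -/

/-- Indices for the data of a model: the value of an integer variable, the number of elements of a
given type, and the number of elements of a given type in an additional set. -/
abbrev Idx : Type := ℕ ⊕ Finset ℕ ⊕ Finset ℕ

/-- The indices of the integer variables and of the types for variables below `n`. -/
def dom (n : ℕ) : Finset Idx := (range n).disjSum ((range n).powerset.disjSum ∅)

/-- The indices that describe how an additional set cuts the types. -/
def cuts (n : ℕ) : Finset Idx := (∅ : Finset ℕ).disjSum ((∅ : Finset (Finset ℕ)).disjSum (range n).powerset)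

theorem card_cuts (n : ℕ) : #(cuts n) = 2 ^ n := by simp [cuts]

theorem disjoint_dom_cuts (n : ℕ) : Disjoint (dom n) (cuts n) := by
  rw [Finset.disjoint_left]
  rintro (k | A | A) <;> simp [dom, cuts]

theorem sum_dom (n : ℕ) (f : Idx → ℤ) : ∑ i ∈ dom n, f i =
    ∑ k ∈ range n, f (.inl k) + ∑ A ∈ (range n).powerset, f (.inr (.inl A)) := by
  simp [dom, sum_disjSum]

theorem sum_cuts (n : ℕ) (f : Idx → ℤ) : ∑ i ∈ cuts n, f i =
    ∑ A ∈ (range n).powerset, f (.inr (.inr A)) := by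
  simp [cuts]

open Classical in
/-- The type of an element: the set variables below `n` to whose value it belongs. -/
noncomputable def typ {U : Type u} (n : ℕ) (ρ : ℕ → Set U) (e : U) : Finset ℕ :=
  (range n).filter fun x => e ∈ ρ x

/-- The data of a model with an additional set `s`. -/
noncomputable def vecCut {U : Type u} (n : ℕ) (ρ : ℕ → Set U) (σ : ℕ → ℤ) (s : Set U) : Idx → ℤ
  | .inl k => σ k
  | .inr (.inl A) => ({e | typ n ρ e = A}.ncard : ℤ)
  | .inr (.inr A) => ((s ∩ {e | typ n ρ e = A}).ncard : ℤ)

/-- The data of a model. -/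
noncomputable def vec {U : Type u} (n : ℕ) (ρ : ℕ → Set U) (σ : ℕ → ℤ) : Idx → ℤ :=
  vecCut n ρ σ ∅

section

variable {U : Type u} {U' : Type v} {n : ℕ} {ρ : ℕ → Set U} {σ : ℕ → ℤ}
  {ρ' : ℕ → Set U'} {σ' : ℕ → ℤ}

theorem typ_mem (n : ℕ) (ρ : ℕ → Set U) (e : U) : typ n ρ e ∈ (range n).powerset := by
  classical
  exact mem_powerset.2 (filter_subset _ _)

theorem mem_typ {x : ℕ} {e : U} : x ∈ typ n ρ e ↔ x < n ∧ e ∈ ρ x := by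
  classical
  simp [typ]

open Classical in
theorem typ_update {x : ℕ} (hx : x < n) (s : Set U) (e : U) :
    typ n (Function.update ρ x s) e =
      if e ∈ s then insert x (typ n ρ e) else (typ n ρ e).erase x := by
  ext y
  by_cases hy : y = x
  · subst hy
    by_cases he : e ∈ s <;> simp [mem_typ, he, hx]
  · by_cases he : e ∈ s <;> simp [mem_typ, he, hy]

theorem vec_eq_vecCut (s : Set U) {i : Idx} (hi : i ∈ dom n) :
    vec n ρ σ i = vecCut n ρ σ s i := by
  rcases i with k | A | A
  · rfl
  · rfl
  · simp [dom] at hi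

-- Double counting: the elements of `s` are grouped by their type. Linear forms in region sizes
-- thereby become sums over elements.
open Classical in
theorem sum_mul_ncard [Fintype U] (c : Finset ℕ → ℤ) (s : Set U) :
    ∑ A ∈ (range n).powerset, c A * ((s ∩ {e | typ n ρ e = A}).ncard : ℤ) =
      ∑ e with e ∈ s, c (typ n ρ e) := by
  rw [← sum_fiberwise_of_maps_to (fun e _ => typ_mem n ρ e)]
  refine sum_congr rfl fun A _ => ?_
  rw [sum_congr rfl (g := fun _ => c A) (fun e he => by rw [(mem_filter.1 he).2])]
  rw [sum_const, nsmul_eq_mul, mul_comm, Set.ncard_eq_toFinset_card']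
  congr 3
  ext e
  simp

open Classical in
theorem sum_mul_vec_type [Fintype U] (c : Finset ℕ → ℤ) :
    ∑ A ∈ (range n).powerset, c A * vec n ρ σ (.inr (.inl A)) = ∑ e : U, c (typ n ρ e) := by
  have := sum_mul_ncard (n := n) (ρ := ρ) c Set.univ
  simpa [vec, vecCut] using this

/-- The linear form on the data of a model and a set `s` that computes a given linear form on the
data after the set variable `x` has been assigned the value `s`. -/
def pullback (x : ℕ) (c : Idx → ℤ) : Idx → ℤ
  | .inl k => c (.inl k)
  | .inr (.inl A) => c (.inr (.inl (A.erase x)))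
  | .inr (.inr A) => c (.inr (.inl (insert x A))) - c (.inr (.inl (A.erase x)))

/-- An element of type `A` moves to `insert x A` if it lies in `s` and to `A.erase x` otherwise.
Charging all elements of type `A` the coefficient of `A.erase x`, and correcting by the difference
on `s`, gives the coefficients in `pullback`. -/
theorem sum_mul_vec_update [Finite U] {x : ℕ} (hx : x < n) (s : Set U) (c : Idx → ℤ) :
    ∑ i ∈ dom n, c i * vec n (Function.update ρ x s) σ i =
      ∑ i ∈ dom n ∪ cuts n, pullback x c i * vecCut n ρ σ s i := by
  classical
  have := Fintype.ofFinite U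
  rw [sum_union (disjoint_dom_cuts n), sum_cuts,
    sum_congr rfl (s₁ := dom n) (f := fun i => pullback x c i * vecCut n ρ σ s i)
      (fun i hi => by rw [← vec_eq_vecCut s hi]), sum_dom, sum_dom]
  have h₁ := sum_mul_vec_type (n := n) (ρ := Function.update ρ x s) (σ := σ)
    fun A => c (.inr (.inl A))
  have h₂ := sum_mul_vec_type (n := n) (ρ := ρ) (σ := σ) fun A => c (.inr (.inl (A.erase x)))
  have h₃ := sum_mul_ncard (n := n) (ρ := ρ)
    (fun A => c (.inr (.inl (insert x A))) - c (.inr (.inl (A.erase x)))) s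
  simp only [pullback, vecCut] at h₃ ⊢
  rw [h₁, h₂, h₃, add_assoc]
  congr 1
  rw [sum_filter, ← sum_add_distrib]
  refine sum_congr rfl fun e _ => ?_
  rw [typ_update hx]
  split_ifs <;> ring

theorem vec_update_int (k : ℕ) (z : ℤ) :
    vec n ρ (Function.update σ k z) = Function.update (vec n ρ σ) (.inl k) z := by
  ext (j | A | A)
  · by_cases hj : j = k
    · subst hj; simp [vec, vecCut]
    · simp [vec, vecCut, hj]
  · simp [vec, vecCut]
  · simp [vec, vecCut]

theorem typ_empty (e : U) : typ n (fun _ => (∅ : Set U)) e = ∅ := by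
  simp [typ]

/-- The types partition `U`, so the region sizes add up to its cardinality. -/
theorem sum_abs_vec [Finite U] :
    ∑ i ∈ dom n, |vec n ρ σ i| = ∑ k ∈ range n, |σ k| + Nat.card U := by
  classical
  have := Fintype.ofFinite U
  rw [sum_dom]
  congr 1
  have := sum_mul_vec_type (n := n) (ρ := ρ) (σ := σ) fun _ => 1
  simp only [one_mul, sum_const, mul_one, card_univ, nsmul_eq_mul] at this
  rw [Nat.card_eq_fintype_card, ← this]
  exact sum_congr rfl fun A _ => by simp [vec, vecCut]

end

/-! ### The back-and-forth property -/

namespace Indist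

section

variable {ι : Type*} [DecidableEq ι] {N : ℕ} {D : Finset ι} {a b : ι → ℤ}

theorem pos_coord (h : Indist N D a b) (hN : 1 ≤ N) {i : ι} (hi : i ∈ D) : 0 < a i ↔ 0 < b i := by
  have := h.pos (Pi.single i 1) 0 (fun j _ => by
    by_cases hj : j = i <;> simp [hj]; exact_mod_cast hN) (by simp)
  simpa [Pi.single_apply, hi] using this

theorem neg_coord (h : Indist N D a b) (hN : 1 ≤ N) {i : ι} (hi : i ∈ D) : a i < 0 ↔ b i < 0 := by
  simpa using h.neg.pos_coord hN hi

theorem lt_coord (h : Indist N D a b) (hN : 1 ≤ N) {i j : ι} (hi : i ∈ D) (hj : j ∈ D) :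
    a i < a j ↔ b i < b j := by
  have hN' : (1 : ℤ) ≤ N := by exact_mod_cast hN
  have := h.pos (Pi.single j 1 - Pi.single i 1) 0 (fun k _ => by
    by_cases hk : k = i <;> by_cases hk' : k = j <;>
      simp [Pi.single_apply, hk, hk'] <;> grind) (by simp)
  simpa [Pi.single_apply, sub_mul, hi, hj] using this

end

variable {U : Type u} {U' : Type v} [Finite U] [Finite U'] {n N : ℕ} {ρ : ℕ → Set U} {σ : ℕ → ℤ}
  {ρ' : ℕ → Set U'} {σ' : ℕ → ℤ}

theorem exists_typ_iff (h : Indist N (dom n) (vec n ρ σ) (vec n ρ' σ')) (hN : 1 ≤ N)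
    (A : Finset ℕ) : (∃ e, typ n ρ e = A) ↔ ∃ e, typ n ρ' e = A := by
  by_cases hA : A ∈ (range n).powerset
  · have := h.pos_coord hN (i := .inr (.inl A)) (by simpa [dom] using hA)
    simpa [vec, vecCut, Set.ncard_pos (Set.toFinite _), Set.Nonempty] using this
  · constructor <;> rintro ⟨e, rfl⟩ <;> exact absurd (typ_mem _ _ _) hA

/-- Up to indistinguishability, a set is given by the sizes of its intersections with the regions.
Those of `s` are answered one by one, and `s'` is assembled from subsets of these sizes. The
precision `2 * N` is needed because the coefficients in `pullback` are differences of two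
coefficients. -/
theorem exists_set (h : Indist (BAPA.refine^[2 ^ n] (2 * N)) (dom n) (vec n ρ σ) (vec n ρ' σ'))
    (hN : 1 ≤ N) {x : ℕ} (hx : x < n) (s : Set U) :
    ∃ s' : Set U', Indist N (dom n) (vec n (Function.update ρ x s) σ)
      (vec n (Function.update ρ' x s') σ') := by
  have hN2 : 1 ≤ 2 * N := by omega
  rw [← card_cuts] at h
  obtain ⟨b, hb, h⟩ := (h.congr (a' := vecCut n ρ σ s) (b' := vec n ρ' σ')
    (fun i hi => (vec_eq_vecCut s hi).symm) fun _ _ => rfl).exists_extend_finset (cuts n)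
      (disjoint_dom_cuts n)
  have hcut : ∀ A : Finset ℕ, ∃ t ⊆ {e | typ n ρ' e = A},
      A ∈ (range n).powerset → (t.ncard : ℤ) = b (.inr (.inr A)) := by
    intro A
    by_cases hA : A ∈ (range n).powerset
    · have hr : (.inr (.inl A) : Idx) ∈ dom n := by simpa [dom] using hA
      have hr' : (.inr (.inl A) : Idx) ∈ dom n ∪ cuts n := mem_union_left _ hr
      have hc' : (.inr (.inr A) : Idx) ∈ dom n ∪ cuts n :=
        mem_union_right _ (by simpa [cuts] using hA)
      -- Being nonnegative and at most the size of the region are sign conditions on small forms, so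
      -- the answers inherit them and are realized by actual subsets.
      have h0 : 0 ≤ b (.inr (.inr A)) := by
        rw [← not_lt, ← h.neg_coord hN2 hc', not_lt]
        simp [vecCut]
      have h1 : b (.inr (.inr A)) ≤ b (.inr (.inl A)) := by
        rw [← not_lt, ← h.lt_coord hN2 hr' hc', not_lt]
        simpa [vecCut] using Set.ncard_le_ncard Set.inter_subset_right (Set.toFinite _)
      rw [hb _ hr] at h1
      obtain ⟨t, ht, hcard⟩ := Set.exists_subset_card_eq (s := {e | typ n ρ' e = A})
        (n := (b (.inr (.inr A))).toNat) (by zify; rw [Int.toNat_of_nonneg h0]; exact h1)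
      exact ⟨t, ht, fun _ => by rw [hcard, Int.toNat_of_nonneg h0]⟩
    · exact ⟨∅, by simp, fun h => absurd h hA⟩
  choose t ht hcard using hcut
  refine ⟨{e | e ∈ t (typ n ρ' e)}, ?_⟩
  set s' : Set U' := {e | e ∈ t (typ n ρ' e)} with hs'
  have hs'A : ∀ A, s' ∩ {e | typ n ρ' e = A} = t A := by
    intro A
    ext e
    constructor
    · rintro ⟨he, rfl⟩
      exact he
    · intro he
      have := ht A he
      simp only [Set.mem_ofPred_eq] at this
      subst this
      exact ⟨he, rfl⟩
  have h : Indist (2 * N) (dom n ∪ cuts n) (vecCut n ρ σ s) (vecCut n ρ' σ' s') := by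
    refine h.congr (fun _ _ => rfl) fun i hi => ?_
    rcases mem_union.1 hi with hi | hi
    · rw [hb i hi, vec_eq_vecCut s' hi]
    · rcases i with k | A | A
      · simp [cuts] at hi
      · simp [cuts] at hi
      · rw [← hcard A (by simpa [cuts] using hi)]
        simp only [vecCut]
        rw [hs'A]
  refine ⟨fun c d hc hd => ?_, fun i hi => ?_⟩
  · rw [sum_mul_vec_update hx, sum_mul_vec_update hx]
    refine h.pos _ d (fun i hi => ?_) (hd.trans (by push_cast; omega))
    have hreg : ∀ B ∈ (range n).powerset, |c (.inr (.inl B))| ≤ N := fun B hB =>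
      hc _ (by simpa [dom] using hB)
    have her : ∀ A ∈ (range n).powerset, |c (.inr (.inl (A.erase x)))| ≤ N := fun A hA =>
      hreg _ (mem_powerset.2 ((erase_subset _ _).trans (mem_powerset.1 hA)))
    rcases i with k | A | A
    · have : |c (.inl k)| ≤ N := hc _ (by simpa [dom, cuts] using hi)
      simp only [pullback]
      push_cast
      omega
    · have := her A (by simpa [dom, cuts] using hi)
      simp only [pullback]
      push_cast
      omega
    · have hA : A ∈ (range n).powerset := by simpa [dom, cuts] using hi
      have h1 := her A hA
      have h2 := hreg (insert x A)
        (mem_powerset.2 (insert_subset (mem_range.2 hx) (mem_powerset.1 hA)))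
      have h3 := abs_sub (c (.inr (.inl (insert x A)))) (c (.inr (.inl (A.erase x))))
      simp only [pullback]
      push_cast
      omega
  -- Each new coordinate is an integral linear form in the old data and the cuts, so congruences
  -- pass to it.
  · have := (h.anti (show N ≤ 2 * N by omega)).sum_modEq (pullback x (Pi.single i 1)) 0
    rw [← sum_mul_vec_update hx, ← sum_mul_vec_update hx] at this
    simpa [Pi.single_apply, hi] using this

-- The old value of variable `k` is forgotten by erasing its coordinate, and the new one is answered
-- as a fresh coordinate.
omit [Finite U] in
theorem exists_int (h : Indist (BAPA.refine N) (dom n) (vec n ρ σ) (vec n ρ' σ'))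
    {k : ℕ} (hk : k < n) (z : ℤ) :
    ∃ z' : ℤ, |z'| ≤ N ! * (∑ k ∈ range n, |σ' k| + Nat.card U' + 2) ∧
      Indist N (dom n) (vec n ρ (Function.update σ k z)) (vec n ρ' (Function.update σ' k z')) := by
  have hk' : (.inl k : Idx) ∈ dom n := by simpa [dom] using hk
  obtain ⟨z', hz, h'⟩ := ((h.subset (erase_subset (.inl k) _)).congr
    (a' := vec n ρ (Function.update σ k z)) (b' := vec n ρ' σ')
    (fun i hi => by rw [vec_update_int, Function.update_of_ne (ne_of_mem_erase hi)])
    fun _ _ => rfl).exists_update (notMem_erase _ _)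
  rw [insert_erase hk', ← vec_update_int] at h'
  refine ⟨z', hz.trans ?_, h'⟩
  rw [← sum_abs_vec (n := n) (ρ := ρ') (σ := σ')]
  have := sum_le_sum_of_subset_of_nonneg (erase_subset (.inl k : Idx) (dom n))
    (f := fun i => |vec n ρ' σ' i|) fun i _ _ => abs_nonneg _
  have hE : (0 : ℤ) ≤ (N ! : ℕ) := by positivity
  exact mul_le_mul_of_nonneg_left (by linarith) hE

end Indist

/-- When all set variables are empty and all integer variables zero, the only coordinate that may be
nonzero is the size of the region of type `∅`, the whole universe. It is answered over the zero
vector, so the bound of `exists_update` reduces to `N! * 2`. -/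
theorem exists_card_indist {U : Type u} [Finite U] (n N : ℕ) (hN : 1 ≤ N) :
    ∃ m ≤ N ! * 2, Indist N (dom n) (vec n (fun _ => (∅ : Set U)) fun _ => 0)
      (vec n (fun _ => (∅ : Set (Fin m))) fun _ => 0) := by
  have h0 : (.inr (.inl ∅) : Idx) ∈ dom n := by simp [dom]
  have hz : ∀ i ∈ (dom n).erase (.inr (.inl ∅)),
      vec n (fun _ => (∅ : Set U)) (fun _ => 0) i = 0 := by
    rintro (k | A | A) hi
    · rfl
    · have hA : A ≠ ∅ := by simpa using ne_of_mem_erase hi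
      simp [vec, vecCut, typ_empty, hA.symm]
    · simp [dom] at hi
  obtain ⟨y, hy, h⟩ := ((Indist.refl (refine N) ((dom n).erase (.inr (.inl ∅))) 0).congr
    (a' := vec n (fun _ => (∅ : Set U)) fun _ => 0) (b' := 0) (fun i hi => hz i hi)
    fun _ _ => rfl).exists_update (notMem_erase _ _)
  rw [insert_erase h0] at h
  have hy0 : 0 ≤ y := by
    have := h.neg_coord hN h0
    simp only [Function.update_self] at this
    rw [← not_lt, ← this]
    simp [vec, vecCut]
  refine ⟨y.toNat, ?_, h.congr (fun _ _ => rfl) ?_⟩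
  · zify
    rw [Int.toNat_of_nonneg hy0]
    simpa [abs_of_nonneg hy0] using hy
  · rintro (k | A | A) hi
    · simp [vec, vecCut]
    · by_cases hA : A = ∅
      · subst hA
        simp [vec, vecCut, typ_empty, hy0]
      · simp [vec, vecCut, typ_empty, hA, Ne.symm hA]
    · simp [dom] at hi

end BAPA

namespace BAPA

open Finset
open scoped Nat

/-! ### Bounds on the codes of subterms -/

theorem lt_node (t a : ℕ) : a < node t a := Nat.lt_succ_of_le (Nat.right_le_pair t a)

theorem left_lt_node (t a b : ℕ) : a < node t (Nat.pair a b) :=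
  (Nat.left_le_pair a b).trans_lt (lt_node _ _)

theorem right_lt_node (t a b : ℕ) : b < node t (Nat.pair a b) :=
  (Nat.right_le_pair a b).trans_lt (lt_node _ _)

theorem two_pow_add_two_pow_le (t a b : ℕ) : 2 ^ a + 2 ^ b ≤ 2 ^ node t (Nat.pair a b) := by
  have ha : 2 ^ (a + 1) ≤ 2 ^ node t (Nat.pair a b) :=
    Nat.pow_le_pow_right two_pos (left_lt_node t a b)
  have hb : 2 ^ (b + 1) ≤ 2 ^ node t (Nat.pair a b) :=
    Nat.pow_le_pow_right two_pos (right_lt_node t a b)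
  rw [pow_succ] at ha hb
  omega

theorem natAbs_le_encode (c : ℤ) : c.natAbs ≤ Encodable.encode c := by
  rcases c with m | m
  · change m ≤ 2 * m
    omega
  · change m + 1 ≤ 2 * m + 1
    omega

/-- The exponents add under multiplication, and a pair code is at least the sum of its components.
-/
theorem abs_mul_two_pow_le (t : ℕ) (c : ℤ) (a : ℕ) :
    |c| * 2 ^ a ≤ 2 ^ node t (Nat.pair (Encodable.encode c) a) := by
  have h₁ : c.natAbs ≤ 2 ^ Encodable.encode c := (natAbs_le_encode c).trans Nat.lt_two_pow_self.le
  have h₂ : Encodable.encode c + a ≤ node t (Nat.pair (Encodable.encode c) a) :=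
    (Nat.add_le_pair _ _).trans (lt_node _ _).le
  have h₃ : c.natAbs * 2 ^ a ≤ 2 ^ node t (Nat.pair (Encodable.encode c) a) := by
    refine le_trans ?_ (Nat.pow_le_pow_right two_pos h₂)
    rw [pow_add]
    exact Nat.mul_le_mul_right _ h₁
  rw [Int.abs_eq_natAbs]
  exact_mod_cast h₃

/-! ### Terms as functions of the data of a model -/

/-- Membership of elements of type `A` in the value of a set term. -/
def SetTerm.Holds (A : Finset ℕ) : SetTerm → Prop
  | .var x => x ∈ A
  | .empty => False
  | .univ => True
  | .union b₁ b₂ => b₁.Holds A ∨ b₂.Holds A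
  | .inter b₁ b₂ => b₁.Holds A ∧ b₂.Holds A
  | .compl b => ¬ b.Holds A

theorem SetTerm.mem_eval_iff {U : Type u} {n : ℕ} {ρ : ℕ → Set U} {b : SetTerm} (hb : b.code ≤ n)
    (e : U) : e ∈ b.eval ρ ↔ b.Holds (typ n ρ e) := by
  induction b with
  | var x => simp [eval, Holds, mem_typ, (lt_node 0 x).trans_le hb]
  | empty => simp [eval, Holds]
  | univ => simp [eval, Holds]
  | union b₁ b₂ h₁ h₂ =>
    simp [eval, Holds, h₁ ((left_lt_node 3 _ _).le.trans hb),
      h₂ ((right_lt_node 3 _ _).le.trans hb)]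
  | inter b₁ b₂ h₁ h₂ =>
    simp [eval, Holds, h₁ ((left_lt_node 4 _ _).le.trans hb),
      h₂ ((right_lt_node 4 _ _).le.trans hb)]
  | compl b h => simp [eval, Holds, h ((lt_node 5 _).le.trans hb)]

open Classical in
/-- The coefficients of an integer term as a linear form in the data of a model. -/
noncomputable def IntTerm.coef : IntTerm → Idx → ℤ
  | .var k => Pi.single (.inl k) 1
  | .const _ => 0
  | .maxCard => Sum.elim 0 1
  | .add t₁ t₂ => t₁.coef + t₂.coef
  | .sub t₁ t₂ => t₁.coef - t₂.coef
  | .smul c t => c • t.coef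
  | .card b => Sum.elim 0 (Sum.elim (fun A => if b.Holds A then 1 else 0) 0)

/-- The constant summand of an integer term as a linear form in the data of a model. -/
def IntTerm.offset : IntTerm → ℤ
  | .var _ => 0
  | .const c => c
  | .maxCard => 0
  | .add t₁ t₂ => t₁.offset + t₂.offset
  | .sub t₁ t₂ => t₁.offset - t₂.offset
  | .smul c t => c * t.offset
  | .card _ => 0

/-- The code serves as a crude size measure for everything in a term, so that precision at least `2
^ n` suffices for all atoms with code at most `n`. -/
theorem IntTerm.abs_coef_le (t : IntTerm) (i : Idx) : |t.coef i| ≤ 2 ^ t.code := by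
  have one : ∀ m : ℕ, (1 : ℤ) ≤ 2 ^ m := fun m => one_le_pow₀ (by norm_num)
  induction t with
  | var k =>
    have := one (IntTerm.var k).code
    by_cases h : i = .inl k
    · simpa [coef, h] using this
    · simp [coef, h]
  | const c => simp [coef]
  | maxCard =>
    have := one IntTerm.maxCard.code
    rcases i with k | i
    · simp [coef]
    · simpa [coef] using this
  | add t₁ t₂ h₁ h₂ =>
    have h₃ : (2 : ℤ) ^ t₁.code + 2 ^ t₂.code ≤ 2 ^ (t₁.add t₂).code := by
      exact_mod_cast two_pow_add_two_pow_le 3 t₁.code t₂.code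
    exact (abs_add_le _ _).trans ((add_le_add h₁ h₂).trans h₃)
  | sub t₁ t₂ h₁ h₂ =>
    have h₃ : (2 : ℤ) ^ t₁.code + 2 ^ t₂.code ≤ 2 ^ (t₁.sub t₂).code := by
      exact_mod_cast two_pow_add_two_pow_le 4 t₁.code t₂.code
    exact (abs_sub _ _).trans ((add_le_add h₁ h₂).trans h₃)
  | smul c t h =>
    refine le_trans ?_ (abs_mul_two_pow_le 5 c t.code)
    simp only [coef, Pi.smul_apply, smul_eq_mul, abs_mul]
    exact mul_le_mul_of_nonneg_left h (abs_nonneg _)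
  | card b =>
    have := one (IntTerm.card b).code
    rcases i with k | A | A
    · simp [coef]
    · by_cases hA : b.Holds A
      · simpa [coef, hA] using this
      · simp [coef, hA]
    · simp [coef]

theorem IntTerm.abs_offset_le (t : IntTerm) : |t.offset| ≤ 2 ^ t.code := by
  induction t with
  | var k => simp [offset]
  | const c =>
    have h := (natAbs_le_encode c).trans ((lt_node 1 _).le.trans Nat.lt_two_pow_self.le)
    rw [offset, Int.abs_eq_natAbs]
    exact_mod_cast h
  | maxCard => simp [offset]
  | add t₁ t₂ h₁ h₂ =>
    have h₃ : (2 : ℤ) ^ t₁.code + 2 ^ t₂.code ≤ 2 ^ (t₁.add t₂).code := by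
      exact_mod_cast two_pow_add_two_pow_le 3 t₁.code t₂.code
    exact (abs_add_le _ _).trans ((add_le_add h₁ h₂).trans h₃)
  | sub t₁ t₂ h₁ h₂ =>
    have h₃ : (2 : ℤ) ^ t₁.code + 2 ^ t₂.code ≤ 2 ^ (t₁.sub t₂).code := by
      exact_mod_cast two_pow_add_two_pow_le 4 t₁.code t₂.code
    exact (abs_sub _ _).trans ((add_le_add h₁ h₂).trans h₃)
  | smul c t h =>
    refine le_trans ?_ (abs_mul_two_pow_le 5 c t.code)
    simp only [offset, abs_mul]
    exact mul_le_mul_of_nonneg_left h (abs_nonneg _)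
  | card b => simp [offset]

theorem IntTerm.eval_eq {U : Type u} [Finite U] {n : ℕ} {ρ : ℕ → Set U} {σ : ℕ → ℤ} {t : IntTerm}
    (ht : t.code ≤ n) :
    t.eval ρ σ = ∑ i ∈ dom n, t.coef i * vec n ρ σ i + t.offset := by
  classical
  have := Fintype.ofFinite U
  induction t with
  | var k =>
    have : (.inl k : Idx) ∈ dom n := by simpa [dom] using (lt_node 0 k).trans_le ht
    simp [eval, coef, offset, Pi.single_apply, this, vec, vecCut]
  | const c => simp [eval, coef, offset]
  | maxCard =>
    have := sum_mul_vec_type (n := n) (ρ := ρ) (σ := σ) fun _ => 1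
    simp only [eval, coef, offset, sum_dom]
    simp at this ⊢
    exact this.symm
  | add t₁ t₂ h₁ h₂ =>
    simp only [eval, coef, offset, h₁ ((left_lt_node 3 _ _).le.trans ht),
      h₂ ((right_lt_node 3 _ _).le.trans ht), Pi.add_apply, add_mul, sum_add_distrib]
    ring
  | sub t₁ t₂ h₁ h₂ =>
    simp only [eval, coef, offset, h₁ ((left_lt_node 4 _ _).le.trans ht),
      h₂ ((right_lt_node 4 _ _).le.trans ht), Pi.sub_apply, sub_mul, sum_sub_distrib]
    ring
  | smul c t h =>
    simp only [eval, coef, offset, h ((right_lt_node 5 _ _).le.trans ht), Pi.smul_apply,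
      smul_eq_mul, mul_assoc, ← mul_sum]
    ring
  | card b =>
    have := sum_mul_vec_type (n := n) (ρ := ρ) (σ := σ) fun A => if b.Holds A then 1 else 0
    simp only [eval, coef, offset, sum_dom, Sum.elim_inl, Sum.elim_inr, this]
    simp only [← SetTerm.mem_eval_iff ((lt_node 6 _).le.trans ht)]
    simp [Set.ncard_eq_toFinset_card']

/-! ### Formulas cannot distinguish indistinguishable models -/

/-- The precision that determines the truth of formulas with code `k` and variables below `n`. -/
def prec (n k : ℕ) : ℕ := refine^[(2 ^ n + 2) * k] (2 ^ n)

theorem iterate_refine_mono (N : ℕ) : Monotone fun k => refine^[k] N :=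
  fun _ _ h => Function.monotone_iterate_of_id_le (fun N => le_refine N) h N

theorem two_pow_le_prec (n k : ℕ) : 2 ^ n ≤ prec n k :=
  iterate_refine_mono (2 ^ n) (Nat.zero_le ((2 ^ n + 2) * k))

/-- Passing to a proper subformula lowers the code by at least one and so frees `2 ^ n + 2`
refinements, more than any quantifier spends. -/
theorem iterate_refine_prec_le {n k m j : ℕ} (hj : j ≤ 2 ^ n + 2) (h : k < m) :
    refine^[j] (prec n k) ≤ prec n m := by
  rw [prec, ← Function.iterate_add_apply]
  refine iterate_refine_mono (2 ^ n) ?_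
  calc j + (2 ^ n + 2) * k ≤ (2 ^ n + 2) * (k + 1) := by rw [mul_add]; omega
    _ ≤ _ := Nat.mul_le_mul_left _ h

theorem one_le_prec (n k : ℕ) : 1 ≤ prec n k := Nat.one_le_two_pow.trans (two_pow_le_prec n k)

section

variable {U : Type u} {U' : Type v} [Finite U] [Finite U'] {n k m : ℕ}
  {ρ : ℕ → Set U} {σ : ℕ → ℤ} {ρ' : ℕ → Set U'} {σ' : ℕ → ℤ}

omit [Finite U] [Finite U'] in
theorem Indist.prec_anti (h : Indist (prec n m) (dom n) (vec n ρ σ) (vec n ρ' σ')) (hk : k < m) :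
    Indist (prec n k) (dom n) (vec n ρ σ) (vec n ρ' σ') :=
  h.anti (iterate_refine_prec_le (Nat.zero_le _) hk)

theorem Indist.exists_set_prec (h : Indist (prec n m) (dom n) (vec n ρ σ) (vec n ρ' σ'))
    (hk : k < m) {x : ℕ} (hx : x < n) (s : Set U) :
    ∃ s' : Set U', Indist (prec n k) (dom n) (vec n (Function.update ρ x s) σ)
      (vec n (Function.update ρ' x s') σ') := by
  refine (h.anti ?_).exists_set (one_le_prec n k) hx s
  -- Of these refinements, `2 ^ n` pay for the cuts and one absorbs the doubling of the precision.
  refine le_trans ?_ (iterate_refine_prec_le (j := 2 ^ n + 1) (by omega) hk)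
  rw [Function.iterate_succ_apply]
  exact Monotone.iterate (fun a b hab => by
    have := Nat.factorial_le hab
    unfold refine
    gcongr) _ (two_mul_le_refine _)

omit [Finite U] in
theorem Indist.exists_int_prec (h : Indist (prec n m) (dom n) (vec n ρ σ) (vec n ρ' σ'))
    (hk : k < m) {x : ℕ} (hx : x < n) (z : ℤ) :
    ∃ z' : ℤ, |z'| ≤ (prec n k)! * (∑ k ∈ range n, |σ' k| + Nat.card U' + 2) ∧
      Indist (prec n k) (dom n) (vec n ρ (Function.update σ x z))
        (vec n ρ' (Function.update σ' x z')) :=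
  (h.anti (iterate_refine_prec_le (j := 1) (by have := Nat.zero_le (2 ^ n); omega) hk)).exists_int hx z

end

theorem Indist.forall_typ_iff {U : Type u} {U' : Type v} [Finite U] [Finite U'] {n N : ℕ}
    {ρ : ℕ → Set U} {σ : ℕ → ℤ} {ρ' : ℕ → Set U'} {σ' : ℕ → ℤ}
    (h : Indist N (dom n) (vec n ρ σ) (vec n ρ' σ')) (hN : 1 ≤ N) (p : Finset ℕ → Prop) :
    (∀ e, p (typ n ρ e)) ↔ ∀ e, p (typ n ρ' e) := by
  have := h.exists_typ_iff hN
  constructor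
  · intro h' e
    obtain ⟨e', he⟩ := (this _).2 ⟨e, rfl⟩
    exact he ▸ h' e'
  · intro h' e
    obtain ⟨e', he⟩ := (this _).1 ⟨e, rfl⟩
    exact he ▸ h' e'

theorem IntTerm.abs_coef_sub_le {n : ℕ} (t : ℕ) (t₁ t₂ : IntTerm)
    (hn : node t (Nat.pair t₁.code t₂.code) ≤ n) {m : ℕ} :
    (∀ i ∈ dom n, |(t₁.sub t₂).coef i| ≤ prec n m) ∧ |(t₁.sub t₂).offset| ≤ prec n m := by
  have h₁ : (2 : ℤ) ^ t₁.code + 2 ^ t₂.code ≤ 2 ^ node t (Nat.pair t₁.code t₂.code) := by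
    exact_mod_cast two_pow_add_two_pow_le t t₁.code t₂.code
  have h₂ : (2 : ℤ) ^ node t (Nat.pair t₁.code t₂.code) ≤ 2 ^ n :=
    pow_le_pow_right₀ (by norm_num) hn
  have h₃ : (2 : ℤ) ^ n ≤ prec n m := by exact_mod_cast two_pow_le_prec n m
  have h₄ := (h₁.trans h₂).trans h₃
  exact ⟨fun i _ => (abs_sub _ _).trans
    ((add_le_add (t₁.abs_coef_le i) (t₂.abs_coef_le i)).trans h₄),
    (abs_sub _ _).trans ((add_le_add t₁.abs_offset_le t₂.abs_offset_le).trans h₄)⟩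

theorem IntTerm.sub_eval_eq {U : Type u} [Finite U] {n : ℕ} {ρ : ℕ → Set U} {σ : ℕ → ℤ}
    (t : ℕ) {t₁ t₂ : IntTerm} (hn : node t (Nat.pair t₁.code t₂.code) ≤ n) :
    t₁.eval ρ σ - t₂.eval ρ σ =
      ∑ i ∈ dom n, (t₁.sub t₂).coef i * vec n ρ σ i + (t₁.sub t₂).offset := by
  rw [IntTerm.eval_eq ((left_lt_node t t₁.code t₂.code).le.trans hn),
    IntTerm.eval_eq ((right_lt_node t t₁.code t₂.code).le.trans hn)]
  simp only [IntTerm.coef, IntTerm.offset, Pi.sub_apply, sub_mul, sum_sub_distrib]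
  ring

/-- This is the back-and-forth induction. The code acts as the rank of the formula, and `n` stays
fixed, so it bounds all variables, bound ones included. -/
theorem Formula.sat_iff_of_indist {U : Type u} {U' : Type v} [Finite U] [Finite U'] {n : ℕ}
    {F : Formula} (hF : F.code ≤ n) {ρ : ℕ → Set U} {σ : ℕ → ℤ} {ρ' : ℕ → Set U'} {σ' : ℕ → ℤ}
    (h : Indist (prec n F.code) (dom n) (vec n ρ σ) (vec n ρ' σ')) :
    F.Sat ρ σ ↔ F.Sat ρ' σ' := by
  induction F generalizing ρ σ ρ' σ' with
  | setEq b₁ b₂ =>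
    have h₁ := (left_lt_node 0 b₁.code b₂.code).le.trans hF
    have h₂ := (right_lt_node 0 b₁.code b₂.code).le.trans hF
    simp only [Sat, Set.ext_iff, SetTerm.mem_eval_iff h₁, SetTerm.mem_eval_iff h₂]
    exact h.forall_typ_iff (one_le_prec n _) fun A => b₁.Holds A ↔ b₂.Holds A
  | subset b₁ b₂ =>
    have h₁ := (left_lt_node 1 b₁.code b₂.code).le.trans hF
    have h₂ := (right_lt_node 1 b₁.code b₂.code).le.trans hF
    simp only [Sat, Set.subset_def, SetTerm.mem_eval_iff h₁, SetTerm.mem_eval_iff h₂]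
    exact h.forall_typ_iff (one_le_prec n _) fun A => b₁.Holds A → b₂.Holds A
  | intEq t₁ t₂ =>
    obtain ⟨hc, hd⟩ := IntTerm.abs_coef_sub_le 2 t₁ t₂ hF
    simp only [Sat]
    rw [← sub_eq_zero, IntTerm.sub_eval_eq 2 hF, ← sub_eq_zero (a := t₁.eval ρ' σ'),
      IntTerm.sub_eval_eq 2 hF]
    exact h.eq_iff hc hd
  | lt t₁ t₂ =>
    obtain ⟨hc, hd⟩ := IntTerm.abs_coef_sub_le 3 t₁ t₂ hF
    simp only [Sat]
    rw [← sub_neg, IntTerm.sub_eval_eq 3 hF, ← sub_neg (a := t₁.eval ρ' σ'),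
      IntTerm.sub_eval_eq 3 hF]
    exact h.neg_iff hc hd
  | dvd c t =>
    have ht : t.code ≤ n := (right_lt_node 4 _ _).le.trans hF
    simp only [Sat]
    rw [IntTerm.eval_eq ht, IntTerm.eval_eq ht]
    -- Divisibility by zero is an equation. A nonzero `c` satisfies `|c| ≤ n`, hence divides the
    -- factorial modulus.
    by_cases hc : c = 0
    · subst hc
      rw [zero_dvd_iff, zero_dvd_iff]
      have hN : (2 : ℤ) ^ n ≤ prec n (dvd 0 t).code := by exact_mod_cast two_pow_le_prec n _
      have hle : (2 : ℤ) ^ t.code ≤ 2 ^ n := pow_le_pow_right₀ (by norm_num) ht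
      exact h.eq_iff (fun i _ => (t.abs_coef_le i).trans (hle.trans hN))
        (t.abs_offset_le.trans (hle.trans hN))
    · have hdvd : c ∣ ((prec n (dvd c t).code)! : ℕ) := by
        rw [← Int.natAbs_dvd_natAbs]
        refine Nat.dvd_factorial (Int.natAbs_pos.2 hc) ?_
        have : c.natAbs ≤ n := (natAbs_le_encode c).trans ((left_lt_node 4 _ t.code).le.trans hF)
        exact this.trans (Nat.lt_two_pow_self.le.trans (two_pow_le_prec n _))
      exact ((h.sum_modEq t.coef t.offset).of_dvd hdvd).dvd_iff
  | and F₁ F₂ h₁ h₂ =>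
    have l := left_lt_node 5 F₁.code F₂.code
    have r := right_lt_node 5 F₁.code F₂.code
    exact and_congr (h₁ (l.le.trans hF) (h.prec_anti l)) (h₂ (r.le.trans hF) (h.prec_anti r))
  | or F₁ F₂ h₁ h₂ =>
    have l := left_lt_node 6 F₁.code F₂.code
    have r := right_lt_node 6 F₁.code F₂.code
    exact or_congr (h₁ (l.le.trans hF) (h.prec_anti l)) (h₂ (r.le.trans hF) (h.prec_anti r))
  | neg F ih =>
    have l := lt_node 7 F.code
    exact not_congr (ih (l.le.trans hF) (h.prec_anti l))
  | exSet x F ih =>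
    have l := (left_lt_node 8 x F.code).trans_le hF
    have r := right_lt_node 8 x F.code
    have ih := fun {ρ σ ρ' σ'} => @ih (r.le.trans hF) ρ σ ρ' σ'
    constructor
    · rintro ⟨s, hs⟩
      obtain ⟨s', h'⟩ := h.exists_set_prec r l s
      exact ⟨s', (ih h').1 hs⟩
    · rintro ⟨s, hs⟩
      obtain ⟨s', h'⟩ := h.symm.exists_set_prec r l s
      exact ⟨s', (ih h'.symm).2 hs⟩
  | allSet x F ih =>
    have l := (left_lt_node 9 x F.code).trans_le hF
    have r := right_lt_node 9 x F.code
    have ih := fun {ρ σ ρ' σ'} => @ih (r.le.trans hF) ρ σ ρ' σ'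
    constructor
    · intro hs s
      obtain ⟨s', h'⟩ := h.symm.exists_set_prec r l s
      exact (ih h'.symm).1 (hs s')
    · intro hs s
      obtain ⟨s', h'⟩ := h.exists_set_prec r l s
      exact (ih h').2 (hs s')
  | exInt x F ih =>
    have l := (left_lt_node 10 x F.code).trans_le hF
    have r := right_lt_node 10 x F.code
    have ih := fun {ρ σ ρ' σ'} => @ih (r.le.trans hF) ρ σ ρ' σ'
    constructor
    · rintro ⟨s, hs⟩
      obtain ⟨s', -, h'⟩ := h.exists_int_prec r l s
      exact ⟨s', (ih h').1 hs⟩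
    · rintro ⟨s, hs⟩
      obtain ⟨s', -, h'⟩ := h.symm.exists_int_prec r l s
      exact ⟨s', (ih h'.symm).2 hs⟩
  | allInt x F ih =>
    have l := (left_lt_node 11 x F.code).trans_le hF
    have r := right_lt_node 11 x F.code
    have ih := fun {ρ σ ρ' σ'} => @ih (r.le.trans hF) ρ σ ρ' σ'
    constructor
    · intro hs s
      obtain ⟨s', -, h'⟩ := h.symm.exists_int_prec r l s
      exact (ih h'.symm).1 (hs s')
    · intro hs s
      obtain ⟨s', -, h'⟩ := h.exists_int_prec r l s
      exact (ih h').2 (hs s')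

end BAPA

namespace BAPA

open scoped Nat

/-! ### Primitive recursion -/

/-- Recursion along a primitive recursive list of smaller arguments is primitive recursive. -/
theorem exists_primrec_rec {β τ : Type} [Primcodable β] [Primcodable τ] {m : β → ℕ}
    {l : β → List β} {g : β → List τ → τ} (hm : Primrec m) (hl : Primrec l) (hg : Primrec₂ g)
    (Ord : ∀ b, ∀ b' ∈ l b, m b' < m b) :
    ∃ f : β → τ, Primrec f ∧ ∀ b, f b = g b ((l b).map f) := by
  let f : β → τ := (measure m).wf.fix fun b F =>
    g b ((l b).attach.map fun x => F x.1 (Ord b x.1 x.2))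
  have hf : ∀ b, f b = g b ((l b).map f) := by
    intro b
    refine ((measure m).wf.fix_eq _ b).trans ?_
    congr 1
    exact List.attach_map_val
  refine ⟨f, Primrec.nat_omega_rec' f hm hl (g := fun b ts => some (g b ts))
    (Primrec.option_some.comp₂ hg) Ord fun b => by rw [← hf], hf⟩

section Prim

open Primrec

theorem primrec_factorial : Primrec Nat.factorial := by
  refine (nat_rec₁ 1 (f := fun n r => (n + 1) * r)
    (nat_mul.comp (succ.comp fst) snd)).of_eq fun n => ?_
  induction n with
  | zero => rfl
  | succ n ih => rw [Nat.factorial_succ, ← ih]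

theorem primrec_pow : Primrec₂ ((· ^ ·) : ℕ → ℕ → ℕ) := Primrec₂.unpaired'.1 Nat.Primrec.pow

theorem primrec_refine : Primrec refine :=
  nat_mul.comp (const 3) (nat_mul.comp primrec_factorial primrec_factorial)

theorem primrec_prec : Primrec₂ prec := by
  have h : Primrec fun p : ℕ × ℕ => 2 ^ p.1 := primrec_pow.comp (const 2) fst
  exact nat_iterate (nat_mul.comp (nat_add.comp h (const 2)) snd) h (primrec_refine.comp snd)

theorem primrec_all : Primrec fun l : List Bool => l.all id := by
  refine (list_foldr (h := fun (_ : List Bool) p => p.1 && p.2) Primrec.id (const true)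
    (Primrec.and.comp (fst.comp snd) (snd.comp snd))).of_eq fun l => ?_
  simp only [id]
  induction l with
  | nil => rfl
  | cons b l ih => simp [ih]

theorem primrec_any : Primrec fun l : List Bool => l.any id := by
  refine (list_foldr (h := fun (_ : List Bool) p => p.1 || p.2) Primrec.id (const false)
    (Primrec.or.comp (fst.comp snd) (snd.comp snd))).of_eq fun l => ?_
  simp only [id]
  induction l with
  | nil => rfl
  | cons b l ih => simp [ih]

/-! ### Primitive recursive integer arithmetic -/

/-- The integer with a given code. -/
def intOfCode (n : ℕ) : ℤ := Denumerable.ofNat ℤ n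

@[simp] theorem intOfCode_encode (z : ℤ) : intOfCode (Encodable.encode z) = z :=
  Denumerable.ofNat_encode z

theorem primrec_intOfCode : Primrec intOfCode := Primrec.ofNat ℤ

theorem ofNat_int (n : ℕ) : Denumerable.ofNat ℤ n =
    if n % 2 = 0 then ((n / 2 : ℕ) : ℤ) else -((n / 2 + 1 : ℕ) : ℤ) := by
  have h : ∀ z : ℤ, Denumerable.ofNat ℤ (Encodable.encode z) = z := Denumerable.ofNat_encode
  split_ifs with hn
  · have : n = Encodable.encode (Int.ofNat (n / 2)) := by
      change n = 2 * (n / 2)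
      omega
    conv_lhs => rw [this, h]
    rfl
  · have : n = Encodable.encode (Int.negSucc (n / 2)) := by
      change n = 2 * (n / 2) + 1
      omega
    conv_lhs => rw [this, h]
    rfl

theorem primrec_toNat : Primrec Int.toNat := by
  rw [Primrec.ofNat_iff]
  refine (ite (Primrec.eq.comp (nat_mod.comp Primrec.id (const 2)) (const 0))
    (nat_div.comp Primrec.id (const 2)) (const 0)).of_eq fun n => ?_
  rw [ofNat_int]
  simp only [id]
  split_ifs <;> omega

theorem primrec_neg_toNat : Primrec fun z : ℤ => (-z).toNat := by
  rw [Primrec.ofNat_iff]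
  refine (ite (Primrec.eq.comp (nat_mod.comp Primrec.id (const 2)) (const 0))
    (const 0) (succ.comp (nat_div.comp Primrec.id (const 2)))).of_eq fun n => ?_
  rw [ofNat_int]
  simp only [id]
  split_ifs <;> omega

/-- Integer operations are carried out on positive and negative parts, which are natural numbers;
this map reassembles the result. -/
theorem primrec_nat_sub_int : Primrec₂ fun p q : ℕ => (p : ℤ) - q := by
  refine Primrec₂.encode_iff.1 ?_
  refine ((ite (nat_le.comp snd fst) (nat_mul.comp (const 2) (nat_sub.comp fst snd))
    (pred.comp (nat_mul.comp (const 2) (nat_sub.comp snd fst)))).to₂.of_eq fun p q => ?_ :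
      Primrec₂ fun p q : ℕ => Encodable.encode ((p : ℤ) - q))
  dsimp only
  split_ifs with h
  · have : (p : ℤ) - q = Int.ofNat (p - q) := by simp; omega
    rw [this]
    rfl
  · have : (p : ℤ) - q = Int.negSucc (q - p - 1) := by rw [Int.negSucc_eq]; omega
    rw [this]
    change _ = 2 * (q - p - 1) + 1
    simp only [Nat.pred_eq_sub_one]
    omega

theorem primrec_int_add : Primrec₂ ((· + ·) : ℤ → ℤ → ℤ) := by
  refine (primrec_nat_sub_int.comp
    (nat_add.comp (primrec_toNat.comp fst) (primrec_toNat.comp snd))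
    (nat_add.comp (primrec_neg_toNat.comp fst) (primrec_neg_toNat.comp snd))).to₂.of_eq fun z w => ?_
  dsimp only
  omega

theorem primrec_int_sub : Primrec₂ ((· - ·) : ℤ → ℤ → ℤ) := by
  refine (primrec_nat_sub_int.comp
    (nat_add.comp (primrec_toNat.comp fst) (primrec_neg_toNat.comp snd))
    (nat_add.comp (primrec_neg_toNat.comp fst) (primrec_toNat.comp snd))).to₂.of_eq fun z w => ?_
  dsimp only
  omega

theorem primrec_int_mul : Primrec₂ ((· * ·) : ℤ → ℤ → ℤ) := by
  have p₁ := primrec_toNat.comp (fst (α := ℤ) (β := ℤ))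
  have q₁ := primrec_neg_toNat.comp (fst (α := ℤ) (β := ℤ))
  have p₂ := primrec_toNat.comp (snd (α := ℤ) (β := ℤ))
  have q₂ := primrec_neg_toNat.comp (snd (α := ℤ) (β := ℤ))
  refine (primrec_nat_sub_int.comp
    (nat_add.comp (nat_mul.comp p₁ p₂) (nat_mul.comp q₁ q₂))
    (nat_add.comp (nat_mul.comp p₁ q₂) (nat_mul.comp q₁ p₂))).to₂.of_eq fun z w => ?_
  push_cast
  have hz : (z.toNat : ℤ) - (-z).toNat = z := by omega
  have hw : (w.toNat : ℤ) - (-w).toNat = w := by omega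
  conv_rhs => rw [← hz, ← hw]
  ring

theorem primrec_int_lt : PrimrecRel ((· < ·) : ℤ → ℤ → Prop) := by
  refine (nat_lt.comp (nat_add.comp (primrec_toNat.comp fst) (primrec_neg_toNat.comp snd))
    (nat_add.comp (primrec_neg_toNat.comp fst) (primrec_toNat.comp snd))).primrecRel.of_eq fun z w => ?_
  dsimp only
  omega

theorem primrec_int_dvd : PrimrecRel ((· ∣ ·) : ℤ → ℤ → Prop) := by
  have h : Primrec Int.natAbs := (nat_add.comp primrec_toNat primrec_neg_toNat).of_eq fun z => by
    omega
  refine (Primrec.eq.comp (nat_mod.comp (h.comp snd) (h.comp fst))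
    (const 0)).primrecRel.of_eq fun z w => ?_
  rw [← Int.natAbs_dvd_natAbs, Nat.dvd_iff_mod_eq_zero]

end Prim

/-! ### Taking codes apart -/

/-- The tag of the root of a syntax tree with a given code. -/
def tag (c : ℕ) : ℕ := (c - 1).unpair.1

/-- The arguments of the root of a syntax tree with a given code. -/
def arg (c : ℕ) : ℕ := (c - 1).unpair.2

/-- The first of two arguments of the root. -/
def arg₁ (c : ℕ) : ℕ := (arg c).unpair.1

/-- The second of two arguments of the root. -/
def arg₂ (c : ℕ) : ℕ := (arg c).unpair.2

/-- The candidates for the codes of the immediate subtrees. -/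
def subcodes (c : ℕ) : List ℕ := if c = 0 then [] else [arg c, arg₁ c, arg₂ c]

@[simp] theorem node_ne_zero (t a : ℕ) : node t a ≠ 0 := Nat.succ_ne_zero _
@[simp] theorem tag_node (t a : ℕ) : tag (node t a) = t := by simp [tag, node]
@[simp] theorem arg_node (t a : ℕ) : arg (node t a) = a := by simp [arg, node]
@[simp] theorem arg₁_node (t a b : ℕ) : arg₁ (node t (Nat.pair a b)) = a := by simp [arg₁]
@[simp] theorem arg₂_node (t a b : ℕ) : arg₂ (node t (Nat.pair a b)) = b := by simp [arg₂]

@[simp] theorem subcodes_node (t a : ℕ) :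
    subcodes (node t a) = [a, a.unpair.1, a.unpair.2] := by simp [subcodes, arg₁, arg₂]

theorem arg_lt {c : ℕ} (hc : c ≠ 0) : arg c < c :=
  (Nat.unpair_right_le _).trans_lt (by omega)

theorem arg₁_lt {c : ℕ} (hc : c ≠ 0) : arg₁ c < c := (Nat.unpair_left_le _).trans_lt (arg_lt hc)

theorem arg₂_lt {c : ℕ} (hc : c ≠ 0) : arg₂ c < c := (Nat.unpair_right_le _).trans_lt (arg_lt hc)

theorem lt_of_mem_subcodes {c d : ℕ} (h : d ∈ subcodes c) : d < c := by
  unfold subcodes at h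
  split_ifs at h with hc
  · simp at h
  · simp only [List.mem_cons, List.not_mem_nil, or_false] at h
    rcases h with rfl | rfl | rfl
    exacts [arg_lt hc, arg₁_lt hc, arg₂_lt hc]

section Prim

open Primrec

theorem primrec_tag : Primrec tag := fst.comp (unpair.comp pred)
theorem primrec_arg : Primrec arg := snd.comp (unpair.comp pred)
theorem primrec_arg₁ : Primrec arg₁ := fst.comp (unpair.comp primrec_arg)
theorem primrec_arg₂ : Primrec arg₂ := snd.comp (unpair.comp primrec_arg)

theorem primrec_subcodes : Primrec subcodes :=
  ite (Primrec.eq.comp Primrec.id (const 0)) (const [])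
    (list_cons.comp primrec_arg (list_cons.comp primrec_arg₁ (list_cons.comp primrec_arg₂ (const []))))

/-- Structural recursion on codes with a fixed parameter. -/
theorem exists_primrec_code_rec {γ τ : Type} [Primcodable γ] [Primcodable τ]
    {g : ℕ × γ → List τ → τ} (hg : Primrec₂ g) : ∃ f : ℕ × γ → τ, Primrec f ∧
      ∀ c p, f (c, p) = g (c, p) ((subcodes c).map fun d => f (d, p)) := by
  obtain ⟨f, hf, hfe⟩ := exists_primrec_rec (m := Prod.fst)
    (l := fun x : ℕ × γ => (subcodes x.1).map fun d => (d, x.2)) fst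
    (list_map (primrec_subcodes.comp fst) (Primrec.pair snd (snd.comp fst))) hg (by
      simp only [List.mem_map]
      rintro b _ ⟨d, hd, rfl⟩
      exact lt_of_mem_subcodes hd)
  exact ⟨f, hf, fun c p => by rw [hfe]; simp [Function.comp_def]⟩

end Prim

/-! ### Evaluation over the universe `{0, …, N - 1}` -/

/-- The subset of `{0, …, N - 1}` given by the binary digits of `m`. -/
def bits (N m : ℕ) : Set (Fin N) := {i | m / 2 ^ (i : ℕ) % 2 = 1}

theorem exists_bits_eq {N : ℕ} (s : Set (Fin N)) : ∃ m < 2 ^ N, bits N m = s := by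
  classical
  refine ⟨Nat.ofBits fun i => decide (i ∈ s), Nat.ofBits_lt_two_pow _, ?_⟩
  ext i
  have := Nat.testBit_ofBits_lt (fun i => decide (i ∈ s)) i i.2
  rw [Nat.testBit_eq_decide_div_mod_eq] at this
  simpa [bits] using this

/-- The assignment to the set variables given by a list. -/
def setAsg (N : ℕ) (ρ : List (ℕ × ℕ)) (x : ℕ) : Set (Fin N) := bits N ((ρ.lookup x).getD 0)

/-- The assignment to the integer variables given by a list. -/
def intAsg (σ : List (ℕ × ℤ)) (k : ℕ) : ℤ := (σ.lookup k).getD 0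

theorem setAsg_cons (N : ℕ) (ρ : List (ℕ × ℕ)) (x m : ℕ) :
    setAsg N ((x, m) :: ρ) = Function.update (setAsg N ρ) x (bits N m) := by
  ext y
  by_cases h : y = x
  · subst h; simp [setAsg]
  · simp [setAsg, List.lookup, h, beq_eq_false_iff_ne.2 h]

theorem intAsg_cons (σ : List (ℕ × ℤ)) (k : ℕ) (z : ℤ) :
    intAsg ((k, z) :: σ) = Function.update (intAsg σ) k z := by
  ext y
  by_cases h : y = k
  · subst h; simp [intAsg]
  · simp [intAsg, List.lookup, h, beq_eq_false_iff_ne.2 h]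

open Primrec in
theorem exists_primrec_mem : ∃ f : ℕ × ℕ × List (ℕ × ℕ) → Bool, Primrec f ∧
    ∀ (b : SetTerm) (N : ℕ) (i : Fin N) (ρ : List (ℕ × ℕ)),
      f (b.code, (i : ℕ), ρ) = true ↔ i ∈ b.eval (setAsg N ρ) := by
  -- The list `bs` follows the order of `subcodes`: position 0 is the argument of a unary node,
  -- positions 1 and 2 are those of a binary node. Entries not fitting the tag are ignored.
  let g : ℕ × ℕ × List (ℕ × ℕ) → List Bool → Bool := fun x bs =>
    if tag x.1 = 0 then decide (((x.2.2.lookup (arg x.1)).getD 0) / 2 ^ x.2.1 % 2 = 1) else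
    if tag x.1 = 1 then false else
    if tag x.1 = 2 then true else
    if tag x.1 = 3 then bs.getD 1 false || bs.getD 2 false else
    if tag x.1 = 4 then bs.getD 1 false && bs.getD 2 false else
    !bs.getD 0 false
  have hg : Primrec₂ g := by
    have hc : Primrec fun p : (ℕ × ℕ × List (ℕ × ℕ)) × List Bool => p.1.1 := fst.comp fst
    have ht : ∀ k, PrimrecPred fun p : (ℕ × ℕ × List (ℕ × ℕ)) × List Bool => tag p.1.1 = k :=
      fun k => Primrec.eq.comp (primrec_tag.comp hc) (const k)
    have hb : ∀ k, Primrec fun p : (ℕ × ℕ × List (ℕ × ℕ)) × List Bool => p.2.getD k false :=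
      fun k => (list_getD false).comp snd (const k)
    refine ite (ht 0) ?_ (ite (ht 1) (const _) (ite (ht 2) (const _)
      (ite (ht 3) (Primrec.or.comp (hb 1) (hb 2)) (ite (ht 4) (Primrec.and.comp (hb 1) (hb 2))
        (Primrec.not.comp (hb 0))))))
    refine PrimrecPred.decide (Primrec.eq.comp (nat_mod.comp (nat_div.comp ?_ ?_) (const 2)) (const 1))
    · exact option_getD.comp (listLookup.comp (primrec_arg.comp hc) (snd.comp (snd.comp fst)))
        (const 0)
    · exact primrec_pow.comp (const 2) (fst.comp (snd.comp fst))
  obtain ⟨f, hf, hfe⟩ := exists_primrec_code_rec hg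
  refine ⟨f, hf, fun b N i ρ => ?_⟩
  induction b with
  | var x => rw [hfe]; simp [g, SetTerm.code, SetTerm.eval, setAsg, bits]
  | empty => rw [hfe]; simp [g, SetTerm.code, SetTerm.eval]
  | univ => rw [hfe]; simp [g, SetTerm.code, SetTerm.eval]
  | union b₁ b₂ h₁ h₂ => rw [hfe]; simp [g, SetTerm.code, SetTerm.eval, h₁, h₂]
  | inter b₁ b₂ h₁ h₂ => rw [hfe]; simp [g, SetTerm.code, SetTerm.eval, h₁, h₂]
  | compl b h => rw [hfe]; simp [g, SetTerm.code, SetTerm.eval, ← h]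

end BAPA

namespace BAPA

open scoped Nat

open Primrec in
theorem exists_primrec_intEval : ∃ f : ℕ × ℕ × List (ℕ × ℕ) × List (ℕ × ℤ) → ℤ, Primrec f ∧
    ∀ (t : IntTerm) (N : ℕ) (ρ : List (ℕ × ℕ)) (σ : List (ℕ × ℤ)),
      f (t.code, N, ρ, σ) = t.eval (setAsg N ρ) (intAsg σ) := by
  obtain ⟨f₀, hf₀, hf₀e⟩ := exists_primrec_mem
  let g : ℕ × ℕ × List (ℕ × ℕ) × List (ℕ × ℤ) → List ℤ → ℤ := fun x zs =>
    if tag x.1 = 0 then (x.2.2.2.lookup (arg x.1)).getD 0 else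
    if tag x.1 = 1 then intOfCode (arg x.1) else
    -- Subtracting zero presents the cast to `ℤ` in the form covered by `primrec_nat_sub_int`.
    if tag x.1 = 2 then (x.2.1 : ℤ) - (0 : ℕ) else
    if tag x.1 = 3 then zs.getD 1 0 + zs.getD 2 0 else
    if tag x.1 = 4 then zs.getD 1 0 - zs.getD 2 0 else
    if tag x.1 = 5 then intOfCode (arg₁ x.1) * zs.getD 2 0 else
    ((((List.range x.2.1).map fun i => f₀ (arg x.1, i, x.2.2.1)).filter (· = true)).length : ℤ) -
      (0 : ℕ)
  have hg : Primrec₂ g := by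
    let γ := (ℕ × ℕ × List (ℕ × ℕ) × List (ℕ × ℤ)) × List ℤ
    have hc : Primrec fun p : γ => p.1.1 := fst.comp fst
    have hN : Primrec fun p : γ => p.1.2.1 := fst.comp (snd.comp fst)
    have hρ : Primrec fun p : γ => p.1.2.2.1 := fst.comp (snd.comp (snd.comp fst))
    have hσ : Primrec fun p : γ => p.1.2.2.2 := snd.comp (snd.comp (snd.comp fst))
    have ht : ∀ k, PrimrecPred fun p : γ => tag p.1.1 = k :=
      fun k => Primrec.eq.comp (primrec_tag.comp hc) (const k)
    have hz : ∀ k, Primrec fun p : γ => p.2.getD k 0 :=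
      fun k => (list_getD 0).comp snd (const k)
    have hconst := primrec_intOfCode
    refine ite (ht 0) (option_getD.comp (listLookup.comp (primrec_arg.comp hc) hσ) (const 0))
      (ite (ht 1) (hconst.comp (primrec_arg.comp hc))
      (ite (ht 2) (primrec_nat_sub_int.comp hN (const 0))
      (ite (ht 3) (primrec_int_add.comp (hz 1) (hz 2))
      (ite (ht 4) (primrec_int_sub.comp (hz 1) (hz 2))
      (ite (ht 5) (primrec_int_mul.comp (hconst.comp (primrec_arg₁.comp hc)) (hz 2))
        (primrec_nat_sub_int.comp (list_length.comp ?_) (const 0)))))))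
    refine (listFilter (Primrec.eq.comp Primrec.id (const true))).comp
      (list_map (list_range.comp hN) ?_)
    exact hf₀.comp (Primrec.pair (primrec_arg.comp (hc.comp fst))
      (Primrec.pair snd (hρ.comp fst)))
  obtain ⟨f, hf, hfe⟩ := exists_primrec_code_rec hg
  refine ⟨f, hf, fun t N ρ σ => ?_⟩
  induction t with
  | var k => rw [hfe]; simp [g, IntTerm.code, IntTerm.eval, intAsg]
  | const c => rw [hfe]; simp [g, IntTerm.code, IntTerm.eval]
  | maxCard => rw [hfe]; simp [g, IntTerm.code, IntTerm.eval]
  | add t₁ t₂ h₁ h₂ => rw [hfe]; simp [g, IntTerm.code, IntTerm.eval, h₁, h₂]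
  | sub t₁ t₂ h₁ h₂ => rw [hfe]; simp [g, IntTerm.code, IntTerm.eval, h₁, h₂]
  | smul c t h => rw [hfe]; simp [g, IntTerm.code, IntTerm.eval, h]
  | card b =>
    have h : ((Fin.val '' b.eval (setAsg N ρ)) : Set ℕ) =
        ((Finset.range N).filter fun i => f₀ (b.code, i, ρ) = true : Finset ℕ) := by
      ext i
      simp only [Set.mem_image, Finset.coe_filter, Finset.mem_range, Set.mem_ofPred_eq, ← hf₀e]
      exact ⟨by rintro ⟨i, h, rfl⟩; exact ⟨i.2, h⟩, fun ⟨hi, h⟩ => ⟨⟨i, hi⟩, h, rfl⟩⟩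
    rw [hfe, IntTerm.eval, ← Set.ncard_image_of_injective _ Fin.val_injective, h,
      Set.ncard_coe_finset]
    simp only [g, IntTerm.code, tag_node, arg_node, List.filter_map, List.length_map]
    norm_num
    change _ = (Multiset.filter _ (Multiset.range N)).card
    simp [Multiset.range, Function.comp_def]

/-! ### Bounded search for integer witnesses -/

/-- A bound for the witnesses of a quantified integer variable, for a body with code `c`, variables
below `n`, and data of the model bounded by `S`. -/
def witnessBound (n S c : ℕ) : ℕ := (prec n c)! * (n * S + S + 2)

/-- The list of all integers of absolute value at most `W`. -/
def intRange (W : ℕ) : List ℤ := (List.range (2 * W + 1)).map fun (j : ℕ) => (j : ℤ) - W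

theorem mem_intRange {W : ℕ} {z : ℤ} : z ∈ intRange W ↔ |z| ≤ W := by
  simp only [intRange, List.mem_map, List.mem_range, abs_le]
  constructor
  · rintro ⟨j, hj, rfl⟩
    omega
  · rintro ⟨h₁, h₂⟩
    exact ⟨(z + W).toNat, by omega, by omega⟩

section Prim

open Primrec

theorem primrec_intRange : Primrec intRange :=
  list_map (list_range.comp (succ.comp (nat_mul.comp (const 2) Primrec.id)))
    (primrec_nat_sub_int.comp snd fst)

theorem primrec_witnessBound : Primrec fun x : ℕ × ℕ × ℕ => witnessBound x.1 x.2.1 x.2.2 := by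
  have hS : Primrec fun x : ℕ × ℕ × ℕ => x.2.1 := fst.comp snd
  exact nat_mul.comp (primrec_factorial.comp (primrec_prec.comp fst (snd.comp snd)))
    (nat_add.comp (nat_add.comp (nat_mul.comp fst hS) hS) (const 2))

end Prim

theorem sum_abs_add_card_le {n S N : ℕ} {σ : ℕ → ℤ} (hσ : ∀ k, |σ k| ≤ S) (hN : N ≤ S) :
    ∑ k ∈ Finset.range n, |σ k| + Nat.card (Fin N) + 2 ≤ ((n * S + S + 2 : ℕ) : ℤ) := by
  have h := Finset.sum_le_card_nsmul (Finset.range n) (fun k => |σ k|) S fun k _ => hσ k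
  simp only [Finset.card_range, nsmul_eq_mul] at h
  simp only [Nat.card_eq_fintype_card, Fintype.card_fin]
  push_cast
  have : (N : ℤ) ≤ S := by exact_mod_cast hN
  linarith

/-- The game is played between a model and itself: a witness is answered by a bounded integer in the
same model, and the body cannot tell the two apart. -/
theorem Formula.exists_int_iff_bounded {F : Formula} {n S N k : ℕ} (hF : F.code < n) (hk : k < n)
    {ρ : ℕ → Set (Fin N)} {σ : ℕ → ℤ} (hσ : ∀ k, |σ k| ≤ S) (hN : N ≤ S) :
    (∃ z : ℤ, F.Sat ρ (Function.update σ k z)) ↔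
      ∃ z ∈ intRange (witnessBound n S F.code), F.Sat ρ (Function.update σ k z) := by
  constructor
  · rintro ⟨z, hz⟩
    obtain ⟨z', hz', h⟩ := (Indist.refl (prec n n) (dom n) (vec n ρ σ)).exists_int_prec hF hk z
    refine ⟨z', mem_intRange.2 (hz'.trans ?_), (F.sat_iff_of_indist hF.le h).1 hz⟩
    have := sum_abs_add_card_le (n := n) hσ hN
    rw [witnessBound, Nat.cast_mul]
    exact mul_le_mul_of_nonneg_left this (by positivity)
  · rintro ⟨z, -, hz⟩
    exact ⟨z, hz⟩

theorem Formula.forall_int_iff_bounded {F : Formula} {n S N k : ℕ} (hF : F.code < n) (hk : k < n)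
    {ρ : ℕ → Set (Fin N)} {σ : ℕ → ℤ} (hσ : ∀ k, |σ k| ≤ S) (hN : N ≤ S) :
    (∀ z : ℤ, F.Sat ρ (Function.update σ k z)) ↔
      ∀ z ∈ intRange (witnessBound n S F.code), F.Sat ρ (Function.update σ k z) := by
  constructor
  · exact fun h z _ => h z
  · intro h z
    obtain ⟨z', hz', h'⟩ := (Indist.refl (prec n n) (dom n) (vec n ρ σ)).exists_int_prec hF hk z
    refine (F.sat_iff_of_indist hF.le h').2 (h z' (mem_intRange.2 (hz'.trans ?_)))
    have := sum_abs_add_card_le (n := n) hσ hN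
    rw [witnessBound, Nat.cast_mul]
    exact mul_le_mul_of_nonneg_left this (by positivity)

theorem abs_intAsg_cons_le {σ : List (ℕ × ℤ)} {S W k : ℕ} {z : ℤ} (hσ : ∀ k, |intAsg σ k| ≤ S)
    (hz : |z| ≤ W) (j : ℕ) : |intAsg ((k, z) :: σ) j| ≤ (S + W : ℕ) := by
  rw [intAsg_cons]
  push_cast
  by_cases h : j = k
  · subst h
    simp only [Function.update_self]
    omega
  · rw [Function.update_of_ne h]
    have := hσ j
    omega

/-! ### Evaluation of formulas by exhaustive search -/

/-- The state of the evaluation of a formula: its code, a bound for the variables, the size of the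
universe, a bound for the data of the model, and the assignments. -/
abbrev EvalState : Type := ℕ × ℕ × ℕ × ℕ × List (ℕ × ℕ) × List (ℕ × ℤ)

/-- The states on which the evaluation of a formula depends. -/
def substates (x : EvalState) : List EvalState :=
  if x.1 = 0 then [] else
  if tag x.1 = 8 ∨ tag x.1 = 9 then
    (List.range (2 ^ x.2.2.1)).map fun m =>
      (arg₂ x.1, x.2.1, x.2.2.1, x.2.2.2.1, (arg₁ x.1, m) :: x.2.2.2.2.1, x.2.2.2.2.2) else
  if tag x.1 = 10 ∨ tag x.1 = 11 then
    (intRange (witnessBound x.2.1 x.2.2.2.1 (arg₂ x.1))).map fun z =>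
      (arg₂ x.1, x.2.1, x.2.2.1, x.2.2.2.1 + witnessBound x.2.1 x.2.2.2.1 (arg₂ x.1),
        x.2.2.2.2.1, (arg₁ x.1, z) :: x.2.2.2.2.2) else
  (subcodes x.1).map fun d => (d, x.2)

theorem lt_of_mem_substates {x y : EvalState} (h : y ∈ substates x) : y.1 < x.1 := by
  obtain ⟨c, n, N, S, ρ, σ⟩ := x
  simp only [substates] at h
  split_ifs at h with h₀
  · simp at h
  · obtain ⟨m, -, rfl⟩ := List.mem_map.1 h
    exact arg₂_lt h₀
  · obtain ⟨m, -, rfl⟩ := List.mem_map.1 h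
    exact arg₂_lt h₀
  · obtain ⟨d, hd, rfl⟩ := List.mem_map.1 h
    exact lt_of_mem_subcodes hd

open Primrec in
theorem primrec_substates : Primrec substates := by
  have hc : Primrec fun x : EvalState => x.1 := fst
  have hn : Primrec fun x : EvalState => x.2.1 := fst.comp snd
  have hN : Primrec fun x : EvalState => x.2.2.1 := fst.comp (snd.comp snd)
  have hS : Primrec fun x : EvalState => x.2.2.2.1 := fst.comp (snd.comp (snd.comp snd))
  have hρ : Primrec fun x : EvalState => x.2.2.2.2.1 :=
    fst.comp (snd.comp (snd.comp (snd.comp snd)))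
  have hσ : Primrec fun x : EvalState => x.2.2.2.2.2 :=
    snd.comp (snd.comp (snd.comp (snd.comp snd)))
  have ht : ∀ k, PrimrecPred fun x : EvalState => tag x.1 = k :=
    fun k => Primrec.eq.comp (primrec_tag.comp hc) (const k)
  have ha₁ := primrec_arg₁.comp hc
  have ha₂ := primrec_arg₂.comp hc
  have hW : Primrec fun x : EvalState => witnessBound x.2.1 x.2.2.2.1 (arg₂ x.1) :=
    Primrec.comp (f := fun x : ℕ × ℕ × ℕ => witnessBound x.1 x.2.1 x.2.2)
      (g := fun x : EvalState => (x.2.1, x.2.2.2.1, arg₂ x.1)) primrec_witnessBound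
      (Primrec.pair hn (Primrec.pair hS ha₂))
  have h₁ : Primrec fun x : EvalState => (List.range (2 ^ x.2.2.1)).map fun m =>
      (arg₂ x.1, x.2.1, x.2.2.1, x.2.2.2.1, (arg₁ x.1, m) :: x.2.2.2.2.1, x.2.2.2.2.2) :=
    list_map (list_range.comp (primrec_pow.comp (const 2) hN))
      ((ha₂.comp fst).pair ((hn.comp fst).pair ((hN.comp fst).pair ((hS.comp fst).pair
        ((list_cons.comp ((ha₁.comp fst).pair snd) (hρ.comp fst)).pair (hσ.comp fst))))))
  have h₂ : Primrec fun x : EvalState =>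
      (intRange (witnessBound x.2.1 x.2.2.2.1 (arg₂ x.1))).map fun z =>
        (arg₂ x.1, x.2.1, x.2.2.1, x.2.2.2.1 + witnessBound x.2.1 x.2.2.2.1 (arg₂ x.1),
          x.2.2.2.2.1, (arg₁ x.1, z) :: x.2.2.2.2.2) :=
    list_map (primrec_intRange.comp hW) ((ha₂.comp fst).pair ((hn.comp fst).pair
      ((hN.comp fst).pair ((nat_add.comp (hS.comp fst) (hW.comp fst)).pair
        ((hρ.comp fst).pair (list_cons.comp ((ha₁.comp fst).pair snd) (hσ.comp fst)))))))
  have h₃ : Primrec fun x : EvalState => (subcodes x.1).map fun d => (d, x.2) :=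
    list_map (primrec_subcodes.comp hc) (Primrec.pair snd (snd.comp fst))
  exact ite (Primrec.eq.comp hc (const 0)) (const [])
    (ite ((ht 8).or (ht 9)) h₁ (ite ((ht 10).or (ht 11)) h₂ h₃))

open Primrec in
theorem exists_primrec_sat : ∃ f : EvalState → Bool, Primrec f ∧
    -- Correctness needs `S` to dominate the universe size and all integer values. Each integer
    -- quantifier enlarges `S` by its witness bound, which keeps this invariant.
    ∀ (F : Formula) (n N S : ℕ) (ρ : List (ℕ × ℕ)) (σ : List (ℕ × ℤ)), F.code ≤ n → N ≤ S →
      (∀ k, |intAsg σ k| ≤ S) →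
      (f (F.code, n, N, S, ρ, σ) = true ↔ F.Sat (setAsg N ρ) (intAsg σ)) := by
  obtain ⟨f₀, hf₀, hf₀e⟩ := exists_primrec_mem
  obtain ⟨f₁, hf₁, hf₁e⟩ := exists_primrec_intEval
  let g : EvalState → List Bool → Bool := fun (c, n, N, S, ρ, σ) bs =>
    if tag c = 0 then ((List.range N).map fun i => f₀ (arg₁ c, i, ρ) == f₀ (arg₂ c, i, ρ)).all id else
    if tag c = 1 then ((List.range N).map fun i => !f₀ (arg₁ c, i, ρ) || f₀ (arg₂ c, i, ρ)).all id else
    if tag c = 2 then decide (f₁ (arg₁ c, N, ρ, σ) = f₁ (arg₂ c, N, ρ, σ)) else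
    if tag c = 3 then decide (f₁ (arg₁ c, N, ρ, σ) < f₁ (arg₂ c, N, ρ, σ)) else
    if tag c = 4 then decide (intOfCode (arg₁ c) ∣ f₁ (arg₂ c, N, ρ, σ)) else
    if tag c = 5 then bs.getD 1 false && bs.getD 2 false else
    if tag c = 6 then bs.getD 1 false || bs.getD 2 false else
    if tag c = 7 then !bs.getD 0 false else
    if tag c = 8 ∨ tag c = 10 then bs.any id else
    bs.all id
  have hg : Primrec₂ g := by
    have hc : Primrec fun p : EvalState × List Bool => p.1.1 := fst.comp fst
    have hN : Primrec fun p : EvalState × List Bool => p.1.2.2.1 :=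
      fst.comp (snd.comp (snd.comp fst))
    have hρ : Primrec fun p : EvalState × List Bool => p.1.2.2.2.2.1 :=
      fst.comp (snd.comp (snd.comp (snd.comp (snd.comp fst))))
    have hσ : Primrec fun p : EvalState × List Bool => p.1.2.2.2.2.2 :=
      snd.comp (snd.comp (snd.comp (snd.comp (snd.comp fst))))
    have ht : ∀ k, PrimrecPred fun p : EvalState × List Bool => tag p.1.1 = k :=
      fun k => Primrec.eq.comp (primrec_tag.comp hc) (const k)
    have hb : ∀ k, Primrec fun p : EvalState × List Bool => p.2.getD k false :=
      fun k => (list_getD false).comp snd (const k)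
    have ha₁ := primrec_arg₁.comp hc
    have ha₂ := primrec_arg₂.comp hc
    have hm₁ := hf₀.comp ((ha₁.comp fst).pair (snd.pair (hρ.comp (fst (β := ℕ)))))
    have hm₂ := hf₀.comp ((ha₂.comp fst).pair (snd.pair (hρ.comp (fst (β := ℕ)))))
    have hi₁ := hf₁.comp (ha₁.pair (hN.pair (hρ.pair hσ)))
    have hi₂ := hf₁.comp (ha₂.pair (hN.pair (hρ.pair hσ)))
    exact
      ite (ht 0) (primrec_all.comp (list_map (list_range.comp hN) (Primrec.beq.comp hm₁ hm₂)))
      (ite (ht 1) (primrec_all.comp (list_map (list_range.comp hN)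
        (Primrec.or.comp (Primrec.not.comp hm₁) hm₂)))
      (ite (ht 2) (PrimrecPred.decide (Primrec.eq.comp hi₁ hi₂))
      (ite (ht 3) (PrimrecPred.decide (primrec_int_lt.comp hi₁ hi₂))
      (ite (ht 4) (PrimrecPred.decide (primrec_int_dvd.comp (primrec_intOfCode.comp ha₁) hi₂))
      (ite (ht 5) (Primrec.and.comp (hb 1) (hb 2))
      (ite (ht 6) (Primrec.or.comp (hb 1) (hb 2))
      (ite (ht 7) (Primrec.not.comp (hb 0))
      (ite ((ht 8).or (ht 10)) (primrec_any.comp snd) (primrec_all.comp snd)))))))))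
  obtain ⟨f, hf, hfe⟩ := exists_primrec_rec (m := fun x : EvalState => x.1) fst primrec_substates
    hg fun _ _ => lt_of_mem_substates
  refine ⟨f, hf, fun F n N S ρ σ hF hN hσ => ?_⟩
  induction F generalizing S ρ σ with
  | setEq b₁ b₂ =>
    rw [hfe]
    simp [g, Formula.code, Formula.Sat, Set.ext_iff, Fin.forall_iff, ← hf₀e]
  | subset b₁ b₂ =>
    rw [hfe]
    simp [g, Formula.code, Formula.Sat, Set.subset_def, Fin.forall_iff, ← hf₀e,
      imp_iff_not_or]
  | intEq t₁ t₂ => rw [hfe]; simp [g, Formula.code, Formula.Sat, hf₁e]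
  | lt t₁ t₂ => rw [hfe]; simp [g, Formula.code, Formula.Sat, hf₁e]
  | dvd c t => rw [hfe]; simp [g, Formula.code, Formula.Sat, hf₁e]
  | and F₁ F₂ h₁ h₂ =>
    have l := (left_lt_node 5 F₁.code F₂.code).le.trans hF
    have r := (right_lt_node 5 F₁.code F₂.code).le.trans hF
    rw [hfe]
    simp [g, substates, Formula.code, Formula.Sat, h₁ _ _ _ l hN hσ, h₂ _ _ _ r hN hσ]
  | or F₁ F₂ h₁ h₂ =>
    have l := (left_lt_node 6 F₁.code F₂.code).le.trans hF
    have r := (right_lt_node 6 F₁.code F₂.code).le.trans hF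
    rw [hfe]
    simp [g, substates, Formula.code, Formula.Sat, h₁ _ _ _ l hN hσ, h₂ _ _ _ r hN hσ]
  | neg F ih =>
    have l := (lt_node 7 F.code).le.trans hF
    rw [hfe]
    simp [g, substates, Formula.code, Formula.Sat, ← ih _ _ _ l hN hσ]
  | exSet x F ih =>
    have r := (right_lt_node 8 x F.code).le.trans hF
    rw [hfe]
    simp only [g, substates, Formula.code, Formula.Sat]
    simp [ih _ _ _ r hN hσ, setAsg_cons]
    constructor
    · rintro ⟨m, -, h⟩
      exact ⟨_, h⟩
    · rintro ⟨s, h⟩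
      obtain ⟨m, hm, rfl⟩ := exists_bits_eq s
      exact ⟨m, hm, h⟩
  | allSet x F ih =>
    have r := (right_lt_node 9 x F.code).le.trans hF
    rw [hfe]
    simp only [g, substates, Formula.code, Formula.Sat]
    simp [ih _ _ _ r hN hσ, setAsg_cons]
    constructor
    · intro h s
      obtain ⟨m, hm, rfl⟩ := exists_bits_eq s
      exact h m hm
    · exact fun h m _ => h _
  | exInt k F ih =>
    have l := (left_lt_node 10 k F.code).trans_le hF
    have r := (right_lt_node 10 k F.code).trans_le hF
    rw [hfe, Formula.Sat, F.exists_int_iff_bounded r l hσ hN]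
    simp [g, substates, Formula.code]
    refine exists_congr fun z => and_congr_right fun hz => ?_
    rw [ih _ ρ _ r.le (Nat.le_add_right_of_le hN) (abs_intAsg_cons_le hσ (mem_intRange.1 hz)), intAsg_cons]
  | allInt k F ih =>
    have l := (left_lt_node 11 k F.code).trans_le hF
    have r := (right_lt_node 11 k F.code).trans_le hF
    rw [hfe, Formula.Sat, F.forall_int_iff_bounded r l hσ hN]
    simp [g, substates, Formula.code]
    refine forall_congr' fun z => imp_congr_right fun hz => ?_
    rw [ih _ ρ _ r.le (Nat.le_add_right_of_le hN) (abs_intAsg_cons_le hσ (mem_intRange.1 hz)), intAsg_cons]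

end BAPA

namespace BAPA

open scoped Nat

/-! ### Recognizing the codes of sentences -/

theorem node_arg {c : ℕ} (hc : c ≠ 0) {t : ℕ} (ht : tag c = t) : node t (arg c) = c := by
  subst ht
  simp only [node, tag, arg, Nat.pair_unpair]
  omega

theorem node_args {c : ℕ} (hc : c ≠ 0) {t : ℕ} (ht : tag c = t) :
    node t (Nat.pair (arg₁ c) (arg₂ c)) = c := by
  rw [arg₁, arg₂, Nat.pair_unpair, node_arg hc ht]

theorem encode_intOfCode (n : ℕ) : Encodable.encode (intOfCode n) = n :=
  Denumerable.encode_ofNat n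

open Primrec in
theorem primrec_list_mem : PrimrecRel fun (x : ℕ) (X : List ℕ) => x ∈ X :=
  (nat_lt.comp (list_idxOf.comp fst snd) (list_length.comp snd)).primrecRel.of_eq fun _ _ =>
    List.idxOf_lt_length_iff

-- Validity concerns only codes of sentences, so these must be recognized too. The list `X` of
-- permitted variables enforces scoping; binders of formulas will extend it.
open Primrec in
theorem exists_primrec_setTerm : ∃ f : ℕ × List ℕ → Bool, Primrec f ∧
    ∀ c X, f (c, X) = true ↔ ∃ b : SetTerm, b.code = c ∧ ∀ x ∈ b.setVars, x ∈ X := by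
  let g : ℕ × List ℕ → List Bool → Bool := fun p bs =>
    if p.1 = 0 then false else
    if tag p.1 = 0 then decide (arg p.1 ∈ p.2) else
    -- Constants are coded with argument 0; any other argument gives a number that codes no term.
    if tag p.1 = 1 then decide (arg p.1 = 0) else
    if tag p.1 = 2 then decide (arg p.1 = 0) else
    if tag p.1 = 3 then bs.getD 1 false && bs.getD 2 false else
    if tag p.1 = 4 then bs.getD 1 false && bs.getD 2 false else
    if tag p.1 = 5 then bs.getD 0 false else
    false
  have hg : Primrec₂ g := by
    let γ := (ℕ × List ℕ) × List Bool
    have hc : Primrec fun p : γ => p.1.1 := fst.comp fst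
    have ha := primrec_arg.comp hc
    have ht : ∀ k, PrimrecPred fun p : γ => tag p.1.1 = k :=
      fun k => Primrec.eq.comp (primrec_tag.comp hc) (const k)
    have hb : ∀ k, Primrec fun p : γ => p.2.getD k false :=
      fun k => (list_getD false).comp snd (const k)
    have h0 : Primrec fun p : γ => decide (arg p.1.1 = 0) :=
      PrimrecPred.decide (Primrec.eq.comp ha (const 0))
    have h₂ : Primrec fun p : γ => p.2.getD 1 false && p.2.getD 2 false :=
      Primrec.and.comp (hb 1) (hb 2)
    exact ite (Primrec.eq.comp hc (const 0)) (const _)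
      (ite (ht 0) (PrimrecPred.decide (primrec_list_mem.comp ha (snd.comp fst)))
      (ite (ht 1) h0 (ite (ht 2) h0 (ite (ht 3) h₂ (ite (ht 4) h₂ (ite (ht 5) (hb 0)
        (const _)))))))
  obtain ⟨f, hf, hfe⟩ := exists_primrec_code_rec hg
  refine ⟨f, hf, fun c X => ⟨fun h => ?_, ?_⟩⟩
  · induction c using Nat.strong_induction_on with
    | _ c ih =>
      rw [hfe] at h
      simp only [g] at h
      split_ifs at h with hc t t t t t t
      · exact ⟨.var (arg c), node_arg hc t, by simpa [SetTerm.setVars] using h⟩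
      · refine ⟨.empty, ?_, by simp [SetTerm.setVars]⟩
        rw [SetTerm.code, ← of_decide_eq_true h, node_arg hc t]
      · refine ⟨.univ, ?_, by simp [SetTerm.setVars]⟩
        rw [SetTerm.code, ← of_decide_eq_true h, node_arg hc t]
      · simp [subcodes, hc] at h
        obtain ⟨b₁, e₁, h₁⟩ := ih _ (arg₁_lt hc) h.1
        obtain ⟨b₂, e₂, h₂⟩ := ih _ (arg₂_lt hc) h.2
        refine ⟨.union b₁ b₂, by rw [SetTerm.code, e₁, e₂, node_args hc t], ?_⟩
        simp only [SetTerm.setVars, Finset.mem_union]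
        rintro x (hx | hx)
        exacts [h₁ x hx, h₂ x hx]
      · simp [subcodes, hc] at h
        obtain ⟨b₁, e₁, h₁⟩ := ih _ (arg₁_lt hc) h.1
        obtain ⟨b₂, e₂, h₂⟩ := ih _ (arg₂_lt hc) h.2
        refine ⟨.inter b₁ b₂, by rw [SetTerm.code, e₁, e₂, node_args hc t], ?_⟩
        simp only [SetTerm.setVars, Finset.mem_union]
        rintro x (hx | hx)
        exacts [h₁ x hx, h₂ x hx]
      · simp [subcodes, hc] at h
        obtain ⟨b, e, h⟩ := ih _ (arg_lt hc) h
        exact ⟨.compl b, by rw [SetTerm.code, e, node_arg hc t], h⟩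
  · rintro ⟨b, rfl, h⟩
    induction b with
    | var x => rw [hfe]; simpa [g, SetTerm.code, SetTerm.setVars] using h
    | empty => rw [hfe]; simp [g, SetTerm.code]
    | univ => rw [hfe]; simp [g, SetTerm.code]
    | union b₁ b₂ h₁ h₂ =>
      simp only [SetTerm.setVars, Finset.mem_union] at h
      rw [hfe]
      simp [g, SetTerm.code, h₁ fun x hx => h x (.inl hx), h₂ fun x hx => h x (.inr hx)]
    | inter b₁ b₂ h₁ h₂ =>
      simp only [SetTerm.setVars, Finset.mem_union] at h
      rw [hfe]
      simp [g, SetTerm.code, h₁ fun x hx => h x (.inl hx), h₂ fun x hx => h x (.inr hx)]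
    | compl b ih => rw [hfe]; simp [g, SetTerm.code, ih h]

open Primrec in
theorem exists_primrec_intTerm : ∃ f : ℕ × List ℕ × List ℕ → Bool, Primrec f ∧
    ∀ c X K, f (c, X, K) = true ↔
      ∃ t : IntTerm, t.code = c ∧ (∀ x ∈ t.setVars, x ∈ X) ∧ ∀ k ∈ t.intVars, k ∈ K := by
  obtain ⟨f₀, hf₀, hf₀e⟩ := exists_primrec_setTerm
  let g : ℕ × List ℕ × List ℕ → List Bool → Bool := fun p bs =>
    if p.1 = 0 then false else
    if tag p.1 = 0 then decide (arg p.1 ∈ p.2.2) else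
    -- Every natural number codes an integer, so the argument needs no check.
    if tag p.1 = 1 then true else
    if tag p.1 = 2 then decide (arg p.1 = 0) else
    if tag p.1 = 3 then bs.getD 1 false && bs.getD 2 false else
    if tag p.1 = 4 then bs.getD 1 false && bs.getD 2 false else
    if tag p.1 = 5 then bs.getD 2 false else
    if tag p.1 = 6 then f₀ (arg p.1, p.2.1) else
    false
  have hg : Primrec₂ g := by
    let γ := (ℕ × List ℕ × List ℕ) × List Bool
    have hc : Primrec fun p : γ => p.1.1 := fst.comp fst
    have ha := primrec_arg.comp hc
    have ht : ∀ k, PrimrecPred fun p : γ => tag p.1.1 = k :=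
      fun k => Primrec.eq.comp (primrec_tag.comp hc) (const k)
    have hb : ∀ k, Primrec fun p : γ => p.2.getD k false :=
      fun k => (list_getD false).comp snd (const k)
    have h₂ : Primrec fun p : γ => p.2.getD 1 false && p.2.getD 2 false :=
      Primrec.and.comp (hb 1) (hb 2)
    exact ite (Primrec.eq.comp hc (const 0)) (const _)
      (ite (ht 0) (PrimrecPred.decide (primrec_list_mem.comp ha (snd.comp (snd.comp fst))))
      (ite (ht 1) (const _)
      (ite (ht 2) (PrimrecPred.decide (Primrec.eq.comp ha (const 0)))
      (ite (ht 3) h₂ (ite (ht 4) h₂ (ite (ht 5) (hb 2)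
      (ite (ht 6) (hf₀.comp (ha.pair (fst.comp (snd.comp fst)))) (const _))))))))
  obtain ⟨f, hf, hfe⟩ := exists_primrec_code_rec hg
  refine ⟨f, hf, fun c X K => ⟨fun h => ?_, ?_⟩⟩
  · induction c using Nat.strong_induction_on with
    | _ c ih =>
      rw [hfe] at h
      simp only [g] at h
      split_ifs at h with hc t t t t t t t
      · exact ⟨.var (arg c), node_arg hc t, by simp [IntTerm.setVars],
          by simpa [IntTerm.intVars] using h⟩
      · exact ⟨.const (intOfCode (arg c)), by rw [IntTerm.code, encode_intOfCode, node_arg hc t],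
          by simp [IntTerm.setVars], by simp [IntTerm.intVars]⟩
      · refine ⟨.maxCard, ?_, by simp [IntTerm.setVars], by simp [IntTerm.intVars]⟩
        rw [IntTerm.code, ← of_decide_eq_true h, node_arg hc t]
      · simp [subcodes, hc] at h
        obtain ⟨t₁, e₁, h₁, h₁'⟩ := ih _ (arg₁_lt hc) h.1
        obtain ⟨t₂, e₂, h₂, h₂'⟩ := ih _ (arg₂_lt hc) h.2
        refine ⟨.add t₁ t₂, by rw [IntTerm.code, e₁, e₂, node_args hc t], ?_⟩
        simp only [IntTerm.setVars, IntTerm.intVars, Finset.mem_union]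
        exact ⟨fun x hx => hx.elim (h₁ x) (h₂ x), fun x hx => hx.elim (h₁' x) (h₂' x)⟩
      · simp [subcodes, hc] at h
        obtain ⟨t₁, e₁, h₁, h₁'⟩ := ih _ (arg₁_lt hc) h.1
        obtain ⟨t₂, e₂, h₂, h₂'⟩ := ih _ (arg₂_lt hc) h.2
        refine ⟨.sub t₁ t₂, by rw [IntTerm.code, e₁, e₂, node_args hc t], ?_⟩
        simp only [IntTerm.setVars, IntTerm.intVars, Finset.mem_union]
        exact ⟨fun x hx => hx.elim (h₁ x) (h₂ x), fun x hx => hx.elim (h₁' x) (h₂' x)⟩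
      · simp [subcodes, hc] at h
        obtain ⟨t₁, e₁, h₁⟩ := ih _ (arg₂_lt hc) h
        exact ⟨.smul (intOfCode (arg₁ c)) t₁,
          by rw [IntTerm.code, e₁, encode_intOfCode, node_args hc t], h₁⟩
      · obtain ⟨b, e, h⟩ := (hf₀e _ _).1 h
        exact ⟨.card b, by rw [IntTerm.code, e, node_arg hc t], h, by simp [IntTerm.intVars]⟩
  · rintro ⟨t, rfl, h, h'⟩
    induction t with
    | var x => rw [hfe]; simpa [g, IntTerm.code, IntTerm.intVars] using h'
    | const c => rw [hfe]; simp [g, IntTerm.code]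
    | maxCard => rw [hfe]; simp [g, IntTerm.code]
    | add t₁ t₂ h₁ h₂ =>
      simp only [IntTerm.setVars, IntTerm.intVars, Finset.mem_union] at h h'
      rw [hfe]
      simp [g, IntTerm.code, h₁ (fun x hx => h x (.inl hx)) fun x hx => h' x (.inl hx),
        h₂ (fun x hx => h x (.inr hx)) fun x hx => h' x (.inr hx)]
    | sub t₁ t₂ h₁ h₂ =>
      simp only [IntTerm.setVars, IntTerm.intVars, Finset.mem_union] at h h'
      rw [hfe]
      simp [g, IntTerm.code, h₁ (fun x hx => h x (.inl hx)) fun x hx => h' x (.inl hx),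
        h₂ (fun x hx => h x (.inr hx)) fun x hx => h' x (.inr hx)]
    | smul c t ih => rw [hfe]; simp [g, IntTerm.code, ih h h']
    | card b => rw [hfe]; simp [g, IntTerm.code, (hf₀e _ _).2 ⟨b, rfl, h⟩]

/-- The state of the recognition of a formula: its code and the variables that may be free. -/
abbrev ScopeState : Type := ℕ × List ℕ × List ℕ

/-- The states on which the recognition of a formula depends. -/
def subscopes (x : ScopeState) : List ScopeState :=
  if x.1 = 0 then [] else
  if tag x.1 = 8 ∨ tag x.1 = 9 then [(arg₂ x.1, arg₁ x.1 :: x.2.1, x.2.2)] else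
  if tag x.1 = 10 ∨ tag x.1 = 11 then [(arg₂ x.1, x.2.1, arg₁ x.1 :: x.2.2)] else
  (subcodes x.1).map fun d => (d, x.2)

theorem lt_of_mem_subscopes {x y : ScopeState} (h : y ∈ subscopes x) : y.1 < x.1 := by
  obtain ⟨c, X, K⟩ := x
  simp only [subscopes] at h
  split_ifs at h with h₀
  · simp at h
  · rw [List.mem_singleton.1 h]
    exact arg₂_lt h₀
  · rw [List.mem_singleton.1 h]
    exact arg₂_lt h₀
  · obtain ⟨d, hd, rfl⟩ := List.mem_map.1 h
    exact lt_of_mem_subcodes hd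

open Primrec in
theorem primrec_subscopes : Primrec subscopes := by
  have hc : Primrec fun x : ScopeState => x.1 := fst
  have hX : Primrec fun x : ScopeState => x.2.1 := fst.comp snd
  have hK : Primrec fun x : ScopeState => x.2.2 := snd.comp snd
  have ht : ∀ k, PrimrecPred fun x : ScopeState => tag x.1 = k :=
    fun k => Primrec.eq.comp (primrec_tag.comp hc) (const k)
  have ha₁ := primrec_arg₁.comp hc
  have ha₂ := primrec_arg₂.comp hc
  exact ite (Primrec.eq.comp hc (const 0)) (const [])
    (ite ((ht 8).or (ht 9))
      (list_cons.comp (ha₂.pair ((list_cons.comp ha₁ hX).pair hK)) (const []))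
    (ite ((ht 10).or (ht 11))
      (list_cons.comp (ha₂.pair (hX.pair (list_cons.comp ha₁ hK))) (const []))
    (list_map (primrec_subcodes.comp hc) (Primrec.pair snd (snd.comp fst)))))

open Primrec in
theorem exists_primrec_formula : ∃ f : ScopeState → Bool, Primrec f ∧
    ∀ c X K, f (c, X, K) = true ↔ ∃ F : Formula, F.code = c ∧
      (∀ x ∈ F.freeSetVars, x ∈ X) ∧ ∀ k ∈ F.freeIntVars, k ∈ K := by
  obtain ⟨f₀, hf₀, hf₀e⟩ := exists_primrec_setTerm
  obtain ⟨f₁, hf₁, hf₁e⟩ := exists_primrec_intTerm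
  let g : ScopeState → List Bool → Bool := fun p bs =>
    if p.1 = 0 then false else
    if tag p.1 = 0 ∨ tag p.1 = 1 then f₀ (arg₁ p.1, p.2.1) && f₀ (arg₂ p.1, p.2.1) else
    if tag p.1 = 2 ∨ tag p.1 = 3 then f₁ (arg₁ p.1, p.2) && f₁ (arg₂ p.1, p.2) else
    if tag p.1 = 4 then f₁ (arg₂ p.1, p.2) else
    if tag p.1 = 5 ∨ tag p.1 = 6 then bs.getD 1 false && bs.getD 2 false else
    -- Negation and the four quantifiers share this branch: position 0 holds the argument of a
    -- negation, and for a quantifier `subscopes` is a singleton.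
    if tag p.1 ≤ 11 then bs.getD 0 false else
    false
  have hg : Primrec₂ g := by
    let γ := ScopeState × List Bool
    have hc : Primrec fun p : γ => p.1.1 := fst.comp fst
    have hX : Primrec fun p : γ => p.1.2.1 := fst.comp (snd.comp fst)
    have hp : Primrec fun p : γ => p.1.2 := snd.comp fst
    have ha₁ := primrec_arg₁.comp hc
    have ha₂ := primrec_arg₂.comp hc
    have ht : ∀ k, PrimrecPred fun p : γ => tag p.1.1 = k :=
      fun k => Primrec.eq.comp (primrec_tag.comp hc) (const k)
    have hb : ∀ k, Primrec fun p : γ => p.2.getD k false :=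
      fun k => (list_getD false).comp snd (const k)
    have h₂ : Primrec fun p : γ => p.2.getD 1 false && p.2.getD 2 false :=
      Primrec.and.comp (hb 1) (hb 2)
    have hle : PrimrecPred fun p : γ => tag p.1.1 ≤ 11 := nat_le.comp (primrec_tag.comp hc) (const 11)
    exact ite (Primrec.eq.comp hc (const 0)) (const _)
      (ite ((ht 0).or (ht 1)) (Primrec.and.comp (hf₀.comp (ha₁.pair hX)) (hf₀.comp (ha₂.pair hX)))
      (ite ((ht 2).or (ht 3)) (Primrec.and.comp (hf₁.comp (ha₁.pair hp)) (hf₁.comp (ha₂.pair hp)))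
      (ite (ht 4) (hf₁.comp (ha₂.pair hp))
      (ite ((ht 5).or (ht 6)) h₂ (ite hle (hb 0) (const _))))))
  obtain ⟨f, hf, hfe⟩ := exists_primrec_rec (m := fun x : ScopeState => x.1) fst primrec_subscopes
    hg fun _ _ => lt_of_mem_subscopes
  refine ⟨f, hf, fun c X K => ⟨fun h => ?_, ?_⟩⟩
  · induction c using Nat.strong_induction_on generalizing X K with
    | _ c ih =>
      rw [hfe] at h
      by_cases hc : c = 0
      · simp [g, hc] at h
      have ht : tag c ≤ 11 := by
        by_contra ht
        have : ∀ k ≤ 11, tag c ≠ k := by omega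
        simp [g, hc, ht, this] at h
      interval_cases t : tag c
      case _ =>
        simp [g, hc, t, hf₀e] at h
        obtain ⟨⟨b₁, e₁, h₁⟩, b₂, e₂, h₂⟩ := h
        refine ⟨.setEq b₁ b₂, by rw [Formula.code, e₁, e₂, node_args hc t], ?_⟩
        simp only [Formula.freeSetVars, Formula.freeIntVars, Finset.mem_union]
        exact ⟨fun x hx => hx.elim (h₁ x) (h₂ x), by simp⟩
      case _ =>
        simp [g, hc, t, hf₀e] at h
        obtain ⟨⟨b₁, e₁, h₁⟩, b₂, e₂, h₂⟩ := h
        refine ⟨.subset b₁ b₂, by rw [Formula.code, e₁, e₂, node_args hc t], ?_⟩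
        simp only [Formula.freeSetVars, Formula.freeIntVars, Finset.mem_union]
        exact ⟨fun x hx => hx.elim (h₁ x) (h₂ x), by simp⟩
      case _ =>
        simp [g, hc, t, hf₁e] at h
        obtain ⟨⟨t₁, e₁, h₁, h₁'⟩, t₂, e₂, h₂, h₂'⟩ := h
        refine ⟨.intEq t₁ t₂, by rw [Formula.code, e₁, e₂, node_args hc t], ?_⟩
        simp only [Formula.freeSetVars, Formula.freeIntVars, Finset.mem_union]
        exact ⟨fun x hx => hx.elim (h₁ x) (h₂ x), fun x hx => hx.elim (h₁' x) (h₂' x)⟩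
      case _ =>
        simp [g, hc, t, hf₁e] at h
        obtain ⟨⟨t₁, e₁, h₁, h₁'⟩, t₂, e₂, h₂, h₂'⟩ := h
        refine ⟨.lt t₁ t₂, by rw [Formula.code, e₁, e₂, node_args hc t], ?_⟩
        simp only [Formula.freeSetVars, Formula.freeIntVars, Finset.mem_union]
        exact ⟨fun x hx => hx.elim (h₁ x) (h₂ x), fun x hx => hx.elim (h₁' x) (h₂' x)⟩
      case _ =>
        simp [g, hc, t, hf₁e] at h
        obtain ⟨t₁, e₁, h₁⟩ := h
        exact ⟨.dvd (intOfCode (arg₁ c)) t₁,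
          by rw [Formula.code, e₁, encode_intOfCode, node_args hc t], h₁⟩
      case _ =>
        simp [g, hc, t, subscopes, subcodes] at h
        obtain ⟨F₁, e₁, h₁, h₁'⟩ := ih _ (arg₁_lt hc) _ _ h.1
        obtain ⟨F₂, e₂, h₂, h₂'⟩ := ih _ (arg₂_lt hc) _ _ h.2
        refine ⟨.and F₁ F₂, by rw [Formula.code, e₁, e₂, node_args hc t], ?_⟩
        simp only [Formula.freeSetVars, Formula.freeIntVars, Finset.mem_union]
        exact ⟨fun x hx => hx.elim (h₁ x) (h₂ x), fun x hx => hx.elim (h₁' x) (h₂' x)⟩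
      case _ =>
        simp [g, hc, t, subscopes, subcodes] at h
        obtain ⟨F₁, e₁, h₁, h₁'⟩ := ih _ (arg₁_lt hc) _ _ h.1
        obtain ⟨F₂, e₂, h₂, h₂'⟩ := ih _ (arg₂_lt hc) _ _ h.2
        refine ⟨.or F₁ F₂, by rw [Formula.code, e₁, e₂, node_args hc t], ?_⟩
        simp only [Formula.freeSetVars, Formula.freeIntVars, Finset.mem_union]
        exact ⟨fun x hx => hx.elim (h₁ x) (h₂ x), fun x hx => hx.elim (h₁' x) (h₂' x)⟩
      case _ =>
        simp [g, hc, t, subscopes, subcodes] at h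
        obtain ⟨F, e, h⟩ := ih _ (arg_lt hc) _ _ h
        exact ⟨.neg F, by rw [Formula.code, e, node_arg hc t], h⟩
      case _ =>
        simp [g, hc, t, subscopes] at h
        obtain ⟨F, e, h, h'⟩ := ih _ (arg₂_lt hc) _ _ h
        refine ⟨.exSet (arg₁ c) F, by rw [Formula.code, e, node_args hc t], fun x hx => ?_, h'⟩
        have := Finset.mem_erase.1 hx
        exact (List.mem_cons.1 (h x this.2)).resolve_left this.1
      case _ =>
        simp [g, hc, t, subscopes] at h
        obtain ⟨F, e, h, h'⟩ := ih _ (arg₂_lt hc) _ _ h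
        refine ⟨.allSet (arg₁ c) F, by rw [Formula.code, e, node_args hc t], fun x hx => ?_, h'⟩
        have := Finset.mem_erase.1 hx
        exact (List.mem_cons.1 (h x this.2)).resolve_left this.1
      case _ =>
        simp [g, hc, t, subscopes] at h
        obtain ⟨F, e, h, h'⟩ := ih _ (arg₂_lt hc) _ _ h
        refine ⟨.exInt (arg₁ c) F, by rw [Formula.code, e, node_args hc t], h, fun x hx => ?_⟩
        have := Finset.mem_erase.1 hx
        exact (List.mem_cons.1 (h' x this.2)).resolve_left this.1
      case _ =>
        simp [g, hc, t, subscopes] at h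
        obtain ⟨F, e, h, h'⟩ := ih _ (arg₂_lt hc) _ _ h
        refine ⟨.allInt (arg₁ c) F, by rw [Formula.code, e, node_args hc t], h, fun x hx => ?_⟩
        have := Finset.mem_erase.1 hx
        exact (List.mem_cons.1 (h' x this.2)).resolve_left this.1
  · rintro ⟨F, rfl, h, h'⟩
    have cons_of_erase : ∀ {s : Finset ℕ} {x : ℕ} {L : List ℕ}, (∀ y ∈ s.erase x, y ∈ L) →
        ∀ y ∈ s, y ∈ x :: L := by
      intro s x L h y hy
      by_cases hyx : y = x
      · simp [hyx]
      · exact List.mem_cons_of_mem _ (h y (Finset.mem_erase.2 ⟨hyx, hy⟩))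
    induction F generalizing X K with
    | setEq b₁ b₂ =>
      simp only [Formula.freeSetVars, Finset.mem_union] at h
      rw [hfe]
      simp [g, Formula.code, (hf₀e _ X).2 ⟨b₁, rfl, fun x hx => h x (.inl hx)⟩,
        (hf₀e _ X).2 ⟨b₂, rfl, fun x hx => h x (.inr hx)⟩]
    | subset b₁ b₂ =>
      simp only [Formula.freeSetVars, Finset.mem_union] at h
      rw [hfe]
      simp [g, Formula.code, (hf₀e _ X).2 ⟨b₁, rfl, fun x hx => h x (.inl hx)⟩,
        (hf₀e _ X).2 ⟨b₂, rfl, fun x hx => h x (.inr hx)⟩]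
    | intEq t₁ t₂ =>
      simp only [Formula.freeSetVars, Formula.freeIntVars, Finset.mem_union] at h h'
      rw [hfe]
      simp [g, Formula.code,
        (hf₁e _ X K).2 ⟨t₁, rfl, fun x hx => h x (.inl hx), fun x hx => h' x (.inl hx)⟩,
        (hf₁e _ X K).2 ⟨t₂, rfl, fun x hx => h x (.inr hx), fun x hx => h' x (.inr hx)⟩]
    | lt t₁ t₂ =>
      simp only [Formula.freeSetVars, Formula.freeIntVars, Finset.mem_union] at h h'
      rw [hfe]
      simp [g, Formula.code,
        (hf₁e _ X K).2 ⟨t₁, rfl, fun x hx => h x (.inl hx), fun x hx => h' x (.inl hx)⟩,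
        (hf₁e _ X K).2 ⟨t₂, rfl, fun x hx => h x (.inr hx), fun x hx => h' x (.inr hx)⟩]
    | dvd c t => rw [hfe]; simp [g, Formula.code, (hf₁e _ X K).2 ⟨t, rfl, h, h'⟩]
    | and F₁ F₂ h₁ h₂ =>
      simp only [Formula.freeSetVars, Formula.freeIntVars, Finset.mem_union] at h h'
      rw [hfe]
      simp [g, Formula.code, subscopes,
        h₁ X K (fun x hx => h x (.inl hx)) fun x hx => h' x (.inl hx),
        h₂ X K (fun x hx => h x (.inr hx)) fun x hx => h' x (.inr hx)]
    | or F₁ F₂ h₁ h₂ =>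
      simp only [Formula.freeSetVars, Formula.freeIntVars, Finset.mem_union] at h h'
      rw [hfe]
      simp [g, Formula.code, subscopes,
        h₁ X K (fun x hx => h x (.inl hx)) fun x hx => h' x (.inl hx),
        h₂ X K (fun x hx => h x (.inr hx)) fun x hx => h' x (.inr hx)]
    | neg F ih => rw [hfe]; simp [g, Formula.code, subscopes, ih X K h h']
    | exSet x F ih =>
      rw [hfe]; simp [g, Formula.code, subscopes, ih (x :: X) K (cons_of_erase h) h']
    | allSet x F ih =>
      rw [hfe]; simp [g, Formula.code, subscopes, ih (x :: X) K (cons_of_erase h) h']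
    | exInt k F ih =>
      rw [hfe]; simp [g, Formula.code, subscopes, ih X (k :: K) h (cons_of_erase h')]
    | allInt k F ih =>
      rw [hfe]; simp [g, Formula.code, subscopes, ih X (k :: K) h (cons_of_erase h')]

/-! ### Truth depends only on the free variables -/

section

variable {U : Type u} {ρ ρ' : ℕ → Set U} {σ σ' : ℕ → ℤ}

theorem SetTerm.eval_congr {b : SetTerm} (h : ∀ x ∈ b.setVars, ρ x = ρ' x) :
    b.eval ρ = b.eval ρ' := by
  induction b with
  | var x => exact h x (by simp [setVars])
  | empty => rfl
  | univ => rfl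
  | union b₁ b₂ h₁ h₂ =>
    simp only [setVars, Finset.mem_union] at h
    rw [eval, eval, h₁ fun x hx => h x (.inl hx), h₂ fun x hx => h x (.inr hx)]
  | inter b₁ b₂ h₁ h₂ =>
    simp only [setVars, Finset.mem_union] at h
    rw [eval, eval, h₁ fun x hx => h x (.inl hx), h₂ fun x hx => h x (.inr hx)]
  | compl b ih => rw [eval, eval, ih h]

theorem IntTerm.eval_congr {t : IntTerm} (h : ∀ x ∈ t.setVars, ρ x = ρ' x)
    (h' : ∀ k ∈ t.intVars, σ k = σ' k) : t.eval ρ σ = t.eval ρ' σ' := by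
  induction t with
  | var k => exact h' k (by simp [intVars])
  | const c => rfl
  | maxCard => rfl
  | add t₁ t₂ h₁ h₂ =>
    simp only [setVars, intVars, Finset.mem_union] at h h'
    rw [eval, eval, h₁ (fun x hx => h x (.inl hx)) fun x hx => h' x (.inl hx),
      h₂ (fun x hx => h x (.inr hx)) fun x hx => h' x (.inr hx)]
  | sub t₁ t₂ h₁ h₂ =>
    simp only [setVars, intVars, Finset.mem_union] at h h'
    rw [eval, eval, h₁ (fun x hx => h x (.inl hx)) fun x hx => h' x (.inl hx),
      h₂ (fun x hx => h x (.inr hx)) fun x hx => h' x (.inr hx)]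
  | smul c t ih => rw [eval, eval, ih h h']
  | card b => rw [eval, eval, SetTerm.eval_congr h]

theorem update_congr {α : Type*} {s : Finset ℕ} {a b : ℕ → α} {x : ℕ}
    (h : ∀ y ∈ s.erase x, a y = b y) (v : α) :
    ∀ y ∈ s, Function.update a x v y = Function.update b x v y := by
  intro y hy
  by_cases hyx : y = x
  · subst hyx; simp
  · simp [hyx, h y (Finset.mem_erase.2 ⟨hyx, hy⟩)]

theorem Formula.sat_congr {F : Formula} (h : ∀ x ∈ F.freeSetVars, ρ x = ρ' x)
    (h' : ∀ k ∈ F.freeIntVars, σ k = σ' k) : F.Sat ρ σ ↔ F.Sat ρ' σ' := by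
  induction F generalizing ρ ρ' σ σ' with
  | setEq b₁ b₂ =>
    simp only [freeSetVars, Finset.mem_union] at h
    rw [Sat, Sat, SetTerm.eval_congr fun x hx => h x (.inl hx),
      SetTerm.eval_congr fun x hx => h x (.inr hx)]
  | subset b₁ b₂ =>
    simp only [freeSetVars, Finset.mem_union] at h
    rw [Sat, Sat, SetTerm.eval_congr fun x hx => h x (.inl hx),
      SetTerm.eval_congr fun x hx => h x (.inr hx)]
  | intEq t₁ t₂ =>
    simp only [freeSetVars, freeIntVars, Finset.mem_union] at h h'
    rw [Sat, Sat, IntTerm.eval_congr (fun x hx => h x (.inl hx)) fun x hx => h' x (.inl hx),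
      IntTerm.eval_congr (fun x hx => h x (.inr hx)) fun x hx => h' x (.inr hx)]
  | lt t₁ t₂ =>
    simp only [freeSetVars, freeIntVars, Finset.mem_union] at h h'
    rw [Sat, Sat, IntTerm.eval_congr (fun x hx => h x (.inl hx)) fun x hx => h' x (.inl hx),
      IntTerm.eval_congr (fun x hx => h x (.inr hx)) fun x hx => h' x (.inr hx)]
  | dvd c t => rw [Sat, Sat, IntTerm.eval_congr h h']
  | and F₁ F₂ h₁ h₂ =>
    simp only [freeSetVars, freeIntVars, Finset.mem_union] at h h'
    exact and_congr (h₁ (fun x hx => h x (.inl hx)) fun x hx => h' x (.inl hx))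
      (h₂ (fun x hx => h x (.inr hx)) fun x hx => h' x (.inr hx))
  | or F₁ F₂ h₁ h₂ =>
    simp only [freeSetVars, freeIntVars, Finset.mem_union] at h h'
    exact or_congr (h₁ (fun x hx => h x (.inl hx)) fun x hx => h' x (.inl hx))
      (h₂ (fun x hx => h x (.inr hx)) fun x hx => h' x (.inr hx))
  | neg F ih => exact not_congr (ih h h')
  | exSet x F ih => exact exists_congr fun s => ih (update_congr h s) h'
  | allSet x F ih => exact forall_congr' fun s => ih (update_congr h s) h'
  | exInt k F ih => exact exists_congr fun z => ih h (update_congr h' z)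
  | allInt k F ih => exact forall_congr' fun z => ih h (update_congr h' z)

end

/-! ### Decidability -/

theorem bits_zero (N : ℕ) : bits N 0 = ∅ := by
  ext i
  simp [bits]

theorem vec_empty_eq {U : Type u} {U' : Type v} (n : ℕ) (h : Nat.card U = Nat.card U') :
    vec n (fun _ => (∅ : Set U)) (fun _ => 0) = vec n (fun _ => (∅ : Set U')) fun _ => 0 := by
  ext (k | A | A)
  · rfl
  · by_cases hA : A = ∅
    · subst hA
      simp [vec, vecCut, typ_empty, Set.ncard_univ, h]
    · simp [vec, vecCut, typ_empty, Ne.symm hA]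
  · simp [vec, vecCut]

/-- For a sentence the assignment may be taken empty and zero. Then only the size of the universe
matters, and every size is indistinguishable from one within the bound of `exists_card_indist`. -/
theorem Formula.valid_iff {F : Formula} (hF : F.IsSentence) :
    Formula.Valid.{u} F ↔ ∀ N < (prec F.code F.code)! * 2 + 1,
      F.Sat (fun _ => (∅ : Set (Fin N))) fun _ => 0 := by
  constructor
  · intro h N _
    -- `Fin N` is lifted to the universe level over which validity quantifies; the lift has the same
    -- cardinality and hence the same data.
    refine (F.sat_iff_of_indist le_rfl ?_).1 (h (ULift.{u} (Fin N)) (fun _ => ∅) fun _ => 0)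
    rw [vec_empty_eq (U' := Fin N) F.code (by simp)]
    exact Indist.refl _ _ _
  · intro h U _ ρ σ
    obtain ⟨m, hm, hI⟩ := exists_card_indist (U := U) F.code _ (one_le_prec F.code F.code)
    refine (F.sat_congr (ρ' := fun _ => ∅) (σ' := fun _ => 0) ?_ ?_).2
      ((F.sat_iff_of_indist le_rfl hI).2 (h m (by omega)))
    · simp [hF.1]
    · simp [hF.2]

end BAPA

open BAPA Primrec in
/-- The set of Gödel numbers of those sentences of Boolean algebra with Presburger arithmetic that
are valid over all models with a finite universe is decidable (recursive). -/
theorem mainTheorem1 :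
    ComputablePred (fun n : ℕ =>
      ∃ F : BAPA.Formula, F.code = n ∧ F.IsSentence ∧ BAPA.Formula.Valid.{u} F) := by
  obtain ⟨f, hf, hfe⟩ := exists_primrec_sat
  obtain ⟨w, hw, hwe⟩ := exists_primrec_formula
  -- The code itself serves as the bound on variables, and the universe size as the bound `S`, since
  -- the empty lists assign `∅` and `0` throughout. On a number that is not the code of a sentence,
  -- `w` already rejects.
  let d : ℕ → Bool := fun n => w (n, [], []) &&
    ((List.range ((prec n n).factorial * 2 + 1)).map fun N => f (n, n, N, N, [], [])).all id
  have hd : Primrec d := by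
    have hB : Primrec fun n => (prec n n).factorial * 2 + 1 := succ.comp
      (nat_mul.comp (primrec_factorial.comp (primrec_prec.comp Primrec.id Primrec.id)) (const 2))
    refine Primrec.and.comp (hw.comp (Primrec.id.pair (const _)))
      (primrec_all.comp (list_map (list_range.comp hB) ?_))
    exact hf.comp (fst.pair (fst.pair (snd.pair (snd.pair (const _)))))
  have hsat : ∀ (F : Formula) (N : ℕ), f (F.code, F.code, N, N, [], []) = true ↔
      F.Sat (fun _ => (∅ : Set (Fin N))) fun _ => 0 := by
    intro F N
    have h : setAsg N [] = fun _ => ∅ := funext fun x => by simp [setAsg, bits_zero]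
    rw [hfe F F.code N N [] [] le_rfl le_rfl (by simp [intAsg]), h]
    rfl
  refine (PrimrecPred.computablePred (p := fun n => d n = true)
    (Primrec.eq.comp hd (const true))).of_eq fun n => ?_
  simp only [d, Bool.and_eq_true, hwe]
  constructor
  · rintro ⟨⟨F, rfl, h₁, h₂⟩, h⟩
    have hs : F.IsSentence := ⟨Finset.eq_empty_of_forall_notMem (by simpa using h₁),
      Finset.eq_empty_of_forall_notMem (by simpa using h₂)⟩
    refine ⟨F, rfl, hs, (F.valid_iff hs).2 fun N hN => (hsat F N).1 ?_⟩
    simp only [List.all_map, List.all_eq_true, List.mem_range] at h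
    exact h N hN
  · rintro ⟨F, rfl, hs, hv⟩
    refine ⟨⟨F, rfl, by simp [hs.1], by simp [hs.2]⟩, ?_⟩
    simp only [List.all_map, List.all_eq_true, List.mem_range]
    exact fun N hN => (hsat F N).2 ((F.valid_iff hs).1 hv N hN)
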